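/- Let $\mathbb F_q$ be a finite field and $R=\mathbb F_q[t]$. Let $\mathrm{SO}(7,R)$ be the group of matrices $A\in\mathrm{SL}(7,R)$ preserving the split quadratic form $$Q(x)=x_1x_{-1}+x_2x_{-2}+x_3x_{-3}+x_0^2,$$ i.e. $Q(Ax)=Q(x)$ for all $x\in R^7$, the coordinates being indexed by $1,2,3,0,-3,-2,-1$; this is the group of $R$-points of the adjoint Chevalley group of type $\mathrm B_3$. Let $e_{ij}$ be the matrix units and let $\Omega$ be the set of all elementary root unipotents of $\mathrm{SO}(7,R)$ with respect to the diagonal torus, that is, of all matrices $$1+\xi e_{ij}-\xi e_{-j,-i}\quad(i,j\neq 0,\ i\neq\pm j)\qquad\text{and}\qquad 1+2\xi e_{i0}-\xi e_{0,-i}-\xi^2e_{i,-i}\quad(i\neq 0),\qquad \xi\in R .$$ Let $E(\mathrm B_3,R)=\langle\Omega\rangle\leq\mathrm{SO}(7,R)$ be the elementary subgroup. The elementary width $w_E(\mathrm{SO}(7,R))$ is the supremum, over all $g\in E(\mathrm B_3,R)$, of the least $k$ such that $g$ is a product of $k$ elements of $\Omega$. Then $w_E(\mathrm{SO}(7,\mathbb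 F_q[t]))$ is finite and, moreover, $$w_E\big(\mathrm{SO}(7,\mathbb F_q[t])\big)\leq 65 .$$ -/

import Mathlib

section Width

variable {G : Type*} [Group G]

/-- The length `l_X(g)`: the least `k` such that `g` is a product of `k` elements of `X`
(the empty product being `1`), and `⊤` if `g` is not a product of elements of `X`. -/
noncomputable def wordLength (X : Set G) (g : G) : ℕ∞ :=
  ⨅ (l : List G) (_ : (∀ x ∈ l, x ∈ X) ∧ l.prod = g), (l.length : ℕ∞)

/-- The width of the subgroup `⟨X⟩` generated by `X` with respect to `X`: the supremum of the
lengths of its elements, a natural number or `⊤`. -/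
noncomputable def wordWidth (X : Set G) : ℕ∞ :=
  ⨆ g ∈ Subgroup.closure X, wordLength X g

end Width

section SO7

open Matrix

variable (R : Type*) [CommRing R]

variable {R} in
/-- The split quadratic form in seven variables. The coordinates are ordered by the weights
`ε₁, ε₂, ε₃, 0, -ε₃, -ε₂, -ε₁` of the vector representation of type `B₃`, so that `Fin.rev`
changes the sign of the weight. -/
def splitForm7 (v : Fin 7 → R) : R :=
  v 0 * v 6 + v 1 * v 5 + v 2 * v 4 + v 3 ^ 2

/-- The split special orthogonal group `SO(7, R)` over an arbitrary commutative ring, including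
characteristic two: the matrices of determinant one that preserve the quadratic form
(not only its polar form). -/
def SO7 : Subgroup (SpecialLinearGroup (Fin 7) R) where
  carrier := {A : SpecialLinearGroup (Fin 7) R | ∀ v : Fin 7 → R,
    splitForm7 ((A : Matrix (Fin 7) (Fin 7) R) *ᵥ v) = splitForm7 v}
  one_mem' := by intro v; simp
  mul_mem' := by
    intro A B hA hB v
    have h : ((A * B : SpecialLinearGroup (Fin 7) R) : Matrix (Fin 7) (Fin 7) R) *ᵥ v =
        (A : Matrix (Fin 7) (Fin 7) R) *ᵥ ((B : Matrix (Fin 7) (Fin 7) R) *ᵥ v) :=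
      (mulVec_mulVec v A.1 B.1).symm
    exact (congrArg splitForm7 h).trans ((hA _).trans (hB v))
  inv_mem' := by
    intro A hA v
    have h : (A : Matrix (Fin 7) (Fin 7) R) *ᵥ
        (((A⁻¹ : SpecialLinearGroup (Fin 7) R) : Matrix (Fin 7) (Fin 7) R) *ᵥ v) = v := by
      have e : A.1 * (A⁻¹).1 = 1 := congrArg Subtype.val (mul_inv_cancel A)
      rw [mulVec_mulVec, e, one_mulVec]
    exact (hA _).symm.trans (congrArg splitForm7 h)

variable {R}

/-- The matrix of the elementary unipotent for the long root `w i - w j`, where `w i` is the weight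
in position `i`. -/
def longRootMatrix (i j : Fin 7) (ξ : R) : Matrix (Fin 7) (Fin 7) R :=
  1 + single i j ξ - single j.rev i.rev ξ

/-- The matrix of the elementary unipotent for the short root `w i`. -/
def shortRootMatrix (i : Fin 7) (ξ : R) : Matrix (Fin 7) (Fin 7) R :=
  1 + single i 3 (2 * ξ) - single 3 i.rev ξ - single i i.rev (ξ ^ 2)

theorem det_longRootMatrix {i j : Fin 7} (hj : j ≠ 3) (hij : i ≠ j)
    (ξ : R) : (longRootMatrix i j ξ).det = 1 := by
  have hj' : j ≠ j.rev := by clear hij; revert j; decide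
  have hr : j.rev ≠ i.rev := fun h => hij (Fin.rev_injective h).symm
  have hn : single j.rev i.rev (-ξ) = -single j.rev i.rev ξ :=
    map_neg (singleAddMonoidHom j.rev i.rev) ξ
  have : longRootMatrix i j ξ = transvection i j ξ * transvection j.rev i.rev (-ξ) := by
    simp only [longRootMatrix, transvection, mul_add, add_mul, one_mul, mul_one]
    rw [single_mul_single_of_ne _ _ _ _ hj', hn]
    abel
  rw [this, det_mul, det_transvection_of_ne _ _ hij, det_transvection_of_ne _ _ hr, one_mul]

theorem det_shortRootMatrix {i : Fin 7} (hi : i ≠ 3) (ξ : R) :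
    (shortRootMatrix i ξ).det = 1 := by
  have h1 : i ≠ i.rev := by revert hi; revert i; decide
  have h2 : (3 : Fin 7) ≠ i.rev := by revert hi; revert i; decide
  have hn : single (3 : Fin 7) i.rev (-ξ) = -single (3 : Fin 7) i.rev ξ :=
    map_neg (singleAddMonoidHom (3 : Fin 7) i.rev) ξ
  have : shortRootMatrix i ξ =
      transvection i i.rev (ξ ^ 2) * (transvection i 3 (2 * ξ) * transvection 3 i.rev (-ξ)) := by
    have e1 : single i i.rev (ξ ^ 2) * single i (3 : Fin 7) (2 * ξ) = 0 :=
      single_mul_single_of_ne _ _ _ _ h1.symm _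
    have e2 : single i i.rev (ξ ^ 2) * single (3 : Fin 7) i.rev ξ = 0 :=
      single_mul_single_of_ne _ _ _ _ h2.symm _
    have e3 : single i i.rev (ξ ^ 2) * single i i.rev (ξ ^ 2) = 0 :=
      single_mul_single_of_ne _ _ _ _ h1.symm _
    have e4 : single i (3 : Fin 7) (2 * ξ) * single (3 : Fin 7) i.rev ξ =
        single i i.rev (ξ ^ 2) + single i i.rev (ξ ^ 2) := by
      rw [single_mul_single_same, ← single_add]
      congr 1
      ring
    simp only [shortRootMatrix, transvection, mul_add, add_mul, one_mul, mul_one, hn, mul_neg,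
      e1, e2, e3, e4]
    abel
  rw [this, det_mul, det_mul, det_transvection_of_ne _ _ h1, det_transvection_of_ne _ _ hi,
    det_transvection_of_ne _ _ h2, one_mul, one_mul]

theorem splitForm7_longRootMatrix {i j : Fin 7} (hi : i ≠ 3) (hj : j ≠ 3) (hij : i ≠ j)
    (hr : j ≠ i.rev) (ξ : R) (v : Fin 7 → R) :
    splitForm7 (longRootMatrix i j ξ *ᵥ v) = splitForm7 v := by
  simp only [longRootMatrix, add_mulVec, sub_mulVec, one_mulVec, single_mulVec, splitForm7,
    Pi.add_apply, Pi.sub_apply, Function.update_apply, Pi.zero_apply]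
  fin_cases i <;> fin_cases j <;>
    first
    | exact absurd rfl hi
    | exact absurd rfl hj
    | exact absurd rfl hij
    | exact absurd rfl hr
    | (simp [Fin.rev, Fin.ext_iff]; try ring)

theorem splitForm7_shortRootMatrix {i : Fin 7} (hi : i ≠ 3) (ξ : R) (v : Fin 7 → R) :
    splitForm7 (shortRootMatrix i ξ *ᵥ v) = splitForm7 v := by
  simp only [shortRootMatrix, add_mulVec, sub_mulVec, one_mulVec, single_mulVec, splitForm7,
    Pi.add_apply, Pi.sub_apply, Function.update_apply, Pi.zero_apply]
  fin_cases i <;> first | exact absurd rfl hi | (simp [Fin.rev, Fin.ext_iff]; try ring)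

/-- The elementary root unipotent `x_α(ξ)` of `SO(7, R)` for the long root `α = w i - w j`; the
side conditions say that `α` is one of the roots `±ε_a ± ε_b`, `a ≠ b`. (The pairs `(i, j)` and
`(j.rev, i.rev)` give the same root; the parameters then differ by a sign.) -/
def longRootUnipotent (i j : Fin 7) (hi : i ≠ 3) (hj : j ≠ 3) (hij : i ≠ j) (hr : j ≠ i.rev)
    (ξ : R) : SO7 R :=
  ⟨⟨longRootMatrix i j ξ, det_longRootMatrix hj hij ξ⟩,
    splitForm7_longRootMatrix hi hj hij hr ξ⟩

/-- The elementary root unipotent `x_α(ξ)` of `SO(7, R)` for the short root `α = w i`, one of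
`±ε_a`. -/
def shortRootUnipotent (i : Fin 7) (hi : i ≠ 3) (ξ : R) : SO7 R :=
  ⟨⟨shortRootMatrix i ξ, det_shortRootMatrix hi ξ⟩, splitForm7_shortRootMatrix hi ξ⟩

variable (R)

/-- The set `Ω` of all elementary root unipotents `x_α(ξ)`, `α ∈ B₃`, `ξ ∈ R`, relative to the
diagonal torus of `SO(7, R)`. -/
def elementaryRootUnipotents : Set (SO7 R) :=
  {g | (∃ (i j : Fin 7) (hi : i ≠ 3) (hj : j ≠ 3) (hij : i ≠ j) (hr : j ≠ i.rev) (ξ : R),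
          g = longRootUnipotent i j hi hj hij hr ξ) ∨
       (∃ (i : Fin 7) (hi : i ≠ 3) (ξ : R), g = shortRootUnipotent i hi ξ)}

/-- The elementary width of `SO(7, R)`: the width, with respect to the elementary root unipotents,
of the elementary subgroup `E(B₃, R)` that they generate. -/
noncomputable def elementaryWidthSO7 : ℕ∞ :=
  wordWidth (elementaryRootUnipotents R)

end SO7

/-! Elementary elements lift to the eight-dimensional spin representation, realised on split
octonions so that characteristic two needs no separate treatment. The orbit of the highest weight
spinor `e` consists of isotropic unimodular spinors. Over a principal ideal domain, fifteen root
unipotents carry any of these back to `e`, by stable range arguments modulo the finitely many primes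
dividing a nonzero coordinate (`SpinBound.add_fifteen`). An element whose lift fixes `e` lies in a
parabolic subgroup with Levi factor `SL 3` and a unipotent radical made of six root subgroups
(`SpinBound.of_stabilizer`). Transvections of `SL 3` are long root unipotents, so bounded generation
of `SL 3` over `F[X]` remains, with bound 43 (`exists_list_transvection`). The total is 15 + 6 + 43
= 64.

For `SL 3`, one operation makes two entries of the last row coprime and six more leave a matrix `A =
(a, b; c, d)` of `SL 2`. By Dirichlet's theorem for `F[X]`, with control of the degree, `b` and `c`
may be changed modulo `a` into monic irreducibles of degrees `m` and `m + 1`. With `q = |F|`, the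
power of `a` with exponent `(q ^ m - 1) / (q - 1)` is its norm modulo `b`, hence a constant, and
likewise for `c` with `m + 1`. These two exponents are coprime, so `A` is a quotient of two powers
of `A`, each of which has its upper left entry congruent to a unit modulo `b` or modulo `c`. Inside
`SL 3` such a power takes 13 transvections and a diagonal matrix (`isTorusWord_pow`).

Dirichlet's theorem comes from `L`-functions. Those of nontrivial characters are polynomials, and a
positivity argument keeps their zeros outside the closed disc of radius `1 / q`
(`inv_lt_norm_of_eval_eq_zero`). Hence their logarithmic derivatives have coefficients `o(q ^ n)`,
and orthogonality of characters isolates a residue class. -/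

/-! ### Logarithmic derivatives of power series -/

open PowerSeries in
/-- `g` is the logarithmic derivative `X f' / f`. -/
def IsLogDeriv (f g : ℂ⟦X⟧) : Prop := X * d⁄dX ℂ f = f * g

namespace IsLogDeriv

open PowerSeries

variable {f g f' g' : ℂ⟦X⟧}

theorem coeff_eq (h : IsLogDeriv f g) (n : ℕ) : (n : ℂ) * coeff n f = coeff n (f * g) := by
  have h' : X * d⁄dX ℂ f = f * g := h
  rw [← h']
  cases n with
  | zero => simp
  | succ n => rw [coeff_succ_X_mul, coeff_derivative]; push_cast; ring

theorem of_coeff (h : ∀ n : ℕ, (n : ℂ) * coeff n f = coeff n (f * g)) : IsLogDeriv f g := by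
  refine PowerSeries.ext fun n => ?_
  rw [← h]
  cases n with
  | zero => simp
  | succ n => rw [coeff_succ_X_mul, coeff_derivative]; push_cast; ring

theorem mul (h : IsLogDeriv f g) (h' : IsLogDeriv f' g') : IsLogDeriv (f * f') (g + g') := by
  unfold IsLogDeriv at *
  rw [Derivation.leibniz, smul_eq_mul, smul_eq_mul]
  linear_combination f' * h + f * h'

theorem rescale (h : IsLogDeriv f g) (z : ℂ) :
    IsLogDeriv (PowerSeries.rescale z f) (PowerSeries.rescale z g) := by
  refine of_coeff fun n => ?_
  rw [← map_mul, coeff_rescale, coeff_rescale, ← h.coeff_eq]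
  ring

theorem conj (h : IsLogDeriv f g) :
    IsLogDeriv (PowerSeries.map (starRingEnd ℂ) f) (PowerSeries.map (starRingEnd ℂ) g) := by
  refine of_coeff fun n => ?_
  rw [← map_mul, coeff_map, coeff_map, ← h.coeff_eq]
  simp

-- The recursion `n f_n = ∑ f_i g_j` over `i + j = n` has `g_0 = 0`, so it computes `f_n` from
-- earlier coefficients with non-negative weights.
open ComplexOrder in
theorem coeff_nonneg (h : IsLogDeriv f g) (h0 : coeff 0 f = 1) (hg : ∀ n, 0 ≤ coeff n g)
    (n : ℕ) : 0 ≤ coeff n f := by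
  induction n using Nat.strong_induction_on with
  | _ n ih =>
    rcases Nat.eq_zero_or_pos n with rfl | hn
    · rw [h0]; exact zero_le_one
    have hg0 : coeff 0 g = 0 := by
      have := h.coeff_eq 0
      simpa [coeff_mul, h0] using this.symm
    have h1 : 0 ≤ (n : ℂ) * coeff n f := by
      rw [h.coeff_eq, coeff_mul]
      refine Finset.sum_nonneg fun p hp => ?_
      have hp' := Finset.HasAntidiagonal.mem_antidiagonal.mp hp
      rcases Nat.eq_zero_or_pos p.2 with h2 | h2
      · rw [h2, hg0, mul_zero]
      · exact mul_nonneg (ih _ (by omega)) (hg _)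
    have hn' : (0 : ℝ) < n := by exact_mod_cast hn
    rw [Complex.nonneg_iff, ← Complex.ofReal_natCast, Complex.re_ofReal_mul, Complex.im_ofReal_mul] at h1
    rw [Complex.nonneg_iff]
    exact ⟨(mul_nonneg_iff_of_pos_left hn').mp h1.1,
      ((mul_eq_zero.mp h1.2.symm).resolve_left hn'.ne').symm⟩

-- In the recursion for the index `(m + 1) k` the term `f_{mk} g_k` is positive and no term is
-- negative. In particular `f` is not a polynomial.
open ComplexOrder in
theorem coeff_pos (h : IsLogDeriv f g) (h0 : coeff 0 f = 1) (hg : ∀ n, 0 ≤ coeff n g)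
    {k : ℕ} (hk : 0 < k) (hgk : 0 < coeff k g) (m : ℕ) : 0 < coeff (m * k) f := by
  induction m with
  | zero => rw [zero_mul, h0]; exact zero_lt_one
  | succ m ih =>
    have hn : 0 < (m + 1) * k := by positivity
    have h1 : 0 < (((m + 1) * k : ℕ) : ℂ) * coeff ((m + 1) * k) f := by
      rw [h.coeff_eq, coeff_mul]
      refine Finset.sum_pos' (fun p _ => mul_nonneg (h.coeff_nonneg h0 hg _) (hg _))
        ⟨(m * k, k), ?_, mul_pos ih hgk⟩
      rw [Finset.HasAntidiagonal.mem_antidiagonal]; ring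
    have hn' : (0 : ℝ) < ((m + 1) * k : ℕ) := by exact_mod_cast hn
    rw [Complex.pos_iff, ← Complex.ofReal_natCast, Complex.re_ofReal_mul, Complex.im_ofReal_mul] at h1
    rw [Complex.pos_iff]
    exact ⟨(mul_pos_iff_of_pos_left hn').mp h1.1,
      ((mul_eq_zero.mp h1.2.symm).resolve_left hn'.ne').symm⟩

end IsLogDeriv

/-! ### Absolute convergence on a closed disc -/

section SummableAt

open PowerSeries

/-- The power series `f` converges absolutely at radius `r`. -/
def SummableAt (r : ℝ) (f : ℂ⟦X⟧) : Prop := Summable fun n => ‖coeff n f * (r : ℂ) ^ n‖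

theorem SummableAt.mul {r : ℝ} {f g : ℂ⟦X⟧} (hf : SummableAt r f) (hg : SummableAt r g) :
    SummableAt r (f * g) := by
  have := summable_norm_sum_mul_antidiagonal_of_summable_norm hf hg
  refine this.congr fun n => ?_
  rw [coeff_mul, Finset.sum_mul]
  congr 1
  refine Finset.sum_congr rfl fun p hp => ?_
  rw [← Finset.HasAntidiagonal.mem_antidiagonal.mp hp, pow_add]
  ring

theorem summableAt_polynomial (r : ℝ) (p : Polynomial ℂ) : SummableAt r (p : ℂ⟦X⟧) := by
  refine summable_of_ne_finset_zero (s := Finset.range (p.natDegree + 1)) fun n hn => ?_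
  rw [Polynomial.coeff_coe, Polynomial.coeff_eq_zero_of_natDegree_lt (by simpa using hn)]
  simp

theorem SummableAt.tendsto {r : ℝ} {f : ℂ⟦X⟧} (hf : SummableAt r f) :
    Filter.Tendsto (fun n => coeff n f * (r : ℂ) ^ n) Filter.atTop (nhds 0) :=
  tendsto_zero_iff_norm_tendsto_zero.mpr hf.tendsto_atTop_zero

/-- A polynomial without zeros in the closed disc of radius `r` is invertible among the power
series that converge absolutely on that disc. -/
theorem exists_summableAt_mul_eq_one {r : ℝ} (hr : 0 ≤ r) (p : Polynomial ℂ) (hp : p ≠ 0)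
    (hroot : ∀ z ∈ p.roots, r < ‖z‖) : ∃ g : ℂ⟦X⟧, SummableAt r g ∧ (p : ℂ⟦X⟧) * g = 1 := by
  have key : ∀ s : Multiset ℂ, (∀ z ∈ s, r < ‖z‖) → ∃ g : ℂ⟦X⟧, SummableAt r g ∧
      ((s.map fun a => Polynomial.X - Polynomial.C a).prod : Polynomial ℂ) * g = (1 : ℂ⟦X⟧) := by
    intro s
    induction s using Multiset.induction with
    | empty => exact fun _ => ⟨1, by simpa using summableAt_polynomial r 1, by simp⟩
    | cons a s ih =>
      intro hs
      obtain ⟨g, hg, hsg⟩ := ih fun z hz => hs z (Multiset.mem_cons_of_mem hz)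
      have ha : r < ‖a‖ := hs a (Multiset.mem_cons_self a s)
      have ha0 : a ≠ 0 := norm_pos_iff.mp (hr.trans_lt ha)
      -- The inverse of `X - a` is the geometric series with ratio `X / a`, which converges
      -- absolutely for `r < ‖a‖`.
      have hinv : ((Polynomial.X - Polynomial.C a : Polynomial ℂ) : ℂ⟦X⟧) *
          (PowerSeries.mk fun n => -a⁻¹ * a⁻¹ ^ n) = 1 := by
        ext n
        rw [Polynomial.coe_sub, Polynomial.coe_X, Polynomial.coe_C, sub_mul, map_sub,
          coeff_C_mul]
        cases n with
        | zero => simp [ha0]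
        | succ n =>
          rw [coeff_succ_X_mul, coeff_mk, coeff_mk, coeff_one, if_neg (by omega), pow_succ]
          field_simp
          ring
      refine ⟨(PowerSeries.mk fun n => -a⁻¹ * a⁻¹ ^ n) * g, SummableAt.mul ?_ hg, ?_⟩
      · have : Summable fun n : ℕ => ‖a⁻¹‖ * (r / ‖a‖) ^ n :=
          (summable_geometric_of_lt_one (by positivity)
            ((div_lt_one (norm_pos_iff.mpr ha0)).mpr ha)).mul_left _
        refine this.congr fun n => ?_
        rw [coeff_mk]
        simp only [norm_mul, norm_neg, norm_pow, norm_inv, Complex.norm_real,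
          Real.norm_of_nonneg hr, div_eq_mul_inv, mul_pow]
        ring
      · rw [Multiset.map_cons, Multiset.prod_cons, Polynomial.coe_mul]
        linear_combination (((s.map fun a => Polynomial.X - Polynomial.C a).prod : Polynomial ℂ) : ℂ⟦X⟧) * g * hinv + hsg
  obtain ⟨g, hg, h1⟩ := key p.roots hroot
  have hl : p.leadingCoeff ≠ 0 := Polynomial.leadingCoeff_ne_zero.mpr hp
  refine ⟨(Polynomial.C p.leadingCoeff⁻¹ : Polynomial ℂ) * g,
    (summableAt_polynomial r _).mul hg, ?_⟩
  have hsplit := (IsAlgClosed.splits p).eq_prod_roots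
  have hp' : (p : ℂ⟦X⟧) = (Polynomial.C p.leadingCoeff : Polynomial ℂ) *
      ((p.roots.map fun a => Polynomial.X - Polynomial.C a).prod : Polynomial ℂ) := by
    rw [← Polynomial.coe_mul, ← hsplit]
  have hc : ((Polynomial.C p.leadingCoeff : Polynomial ℂ) : ℂ⟦X⟧) *
      (Polynomial.C p.leadingCoeff⁻¹ : Polynomial ℂ) = 1 := by
    rw [← Polynomial.coe_mul, ← Polynomial.C_mul, mul_inv_cancel₀ hl, Polynomial.C_1,
      Polynomial.coe_one]
  rw [hp']
  linear_combination (((p.roots.map fun a => Polynomial.X - Polynomial.C a).prod : Polynomial ℂ) : ℂ⟦X⟧) * g * hc + h1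

end SummableAt

/-! ### Zero-free disc of `L`-polynomials -/

section Nonvanishing

open PowerSeries

theorem coe_comp_C_mul_X (p : Polynomial ℂ) (z : ℂ) :
    ((p.comp (Polynomial.C z * Polynomial.X) : Polynomial ℂ) : ℂ⟦X⟧) = rescale z (p : ℂ⟦X⟧) := by
  ext n
  rw [Polynomial.coeff_coe, Polynomial.comp_C_mul_X_coeff, coeff_rescale, Polynomial.coeff_coe,
    mul_comm]

theorem coe_map_conj (p : Polynomial ℂ) :
    ((p.map (starRingEnd ℂ) : Polynomial ℂ) : ℂ⟦X⟧) =
      PowerSeries.map (starRingEnd ℂ) (p : ℂ⟦X⟧) := by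
  ext n
  simp

open ComplexOrder in
/-- The zeros of an `L`-polynomial `L` whose logarithmic derivative is dominated by that of a zeta
function `A` with a single simple pole at `q⁻¹` lie outside of the closed disc of radius `q⁻¹`:
otherwise the product `A ^ 2 L L̄`, whose logarithm has non-negative coefficients, would have no pole
at that distance from the origin. -/
theorem inv_lt_norm_of_eval_eq_zero {q : ℝ} (hq : 0 < q) {A G₁ G : ℂ⟦X⟧} {L N : Polynomial ℂ}
    (hA : (1 - C (q : ℂ) * X) * A = (N : ℂ⟦X⟧)) (hA0 : coeff 0 A = 1) (hL0 : L.coeff 0 = 1)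
    (lA : IsLogDeriv A G₁) (lL : IsLogDeriv L G) {g : ℕ → ℝ} (hg : ∀ n, coeff n G₁ = g n)
    (dom : ∀ n, ‖coeff n G‖ ≤ g n)
    (pos : ∀ u : ℂ, ‖u‖ = 1 → ∃ k, 0 < k ∧ 0 < g k + (u ^ k * coeff k G).re)
    {z : ℂ} (hz : L.eval z = 0) : q⁻¹ < ‖z‖ := by
  by_contra! hle
  have hz0 : z ≠ 0 := by
    rintro rfl
    rw [← Polynomial.coeff_zero_eq_eval_zero, hL0] at hz
    exact one_ne_zero hz
  have hzn : 0 < ‖z‖ := norm_pos_iff.mpr hz0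
  set ρ : ℝ := q * ‖z‖ with hρ
  have hρ0 : 0 < ρ := mul_pos hq hzn
  have hρ1 : ρ ≤ 1 := by
    have := mul_le_mul_of_nonneg_left hle hq.le
    rwa [mul_inv_cancel₀ hq.ne'] at this
  -- the product with non-negative coefficients
  set A₁ := rescale (‖z‖ : ℂ) A
  set A₂ := rescale z (L : ℂ⟦X⟧) with hA₂
  set A₃ := PowerSeries.map (starRingEnd ℂ) A₂ with hA₃
  set D := A₁ * A₁ * (A₂ * A₃) with hD
  set H₁ := rescale (‖z‖ : ℂ) G₁
  set H₂ := rescale z G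
  set H₃ := PowerSeries.map (starRingEnd ℂ) H₂
  have lD : IsLogDeriv D (H₁ + H₁ + (H₂ + H₃)) :=
    ((lA.rescale _).mul (lA.rescale _)).mul ((lL.rescale z).mul (lL.rescale z).conj)
  have hcoeff : ∀ n, coeff n (H₁ + H₁ + (H₂ + H₃)) =
      ((2 * (‖z‖ ^ n * g n + (z ^ n * coeff n G).re) : ℝ) : ℂ) := by
    intro n
    simp only [H₁, H₂, H₃, map_add, coeff_rescale, coeff_map, hg]
    rw [Complex.add_conj]
    push_cast
    ring
  have hnonneg : ∀ n, 0 ≤ coeff n (H₁ + H₁ + (H₂ + H₃)) := by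
    intro n
    rw [hcoeff]
    have h1 : -(z ^ n * coeff n G).re ≤ ‖z‖ ^ n * g n := by
      refine (neg_le_abs _).trans ((Complex.abs_re_le_norm _).trans ?_)
      rw [norm_mul, norm_pow]
      exact mul_le_mul_of_nonneg_left (dom n) (by positivity)
    exact_mod_cast (by linarith : (0 : ℝ) ≤ 2 * (‖z‖ ^ n * g n + (z ^ n * coeff n G).re))
  have hD0 : coeff 0 D = 1 := by
    have h1 : coeff 0 A₁ = 1 := by rw [coeff_rescale, hA0]; simp
    have h2 : coeff 0 A₂ = 1 := by rw [coeff_rescale, Polynomial.coeff_coe, hL0]; simp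
    have h3 : coeff 0 A₃ = 1 := by rw [coeff_map, h2, map_one]
    rw [coeff_zero_eq_constantCoeff_apply] at h1 h2 h3
    rw [coeff_zero_eq_constantCoeff_apply, hD, map_mul, map_mul, map_mul, h1, h2, h3]
    norm_num
  -- the zeros at `1`
  obtain ⟨M, hM⟩ : (Polynomial.X - Polynomial.C 1) ∣ L.comp (Polynomial.C z * Polynomial.X) :=
    Polynomial.dvd_iff_isRoot.mpr (by simp [hz])
  obtain ⟨M', hM'⟩ : (Polynomial.X - Polynomial.C 1) ∣
      (L.comp (Polynomial.C z * Polynomial.X)).map (starRingEnd ℂ) := by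
    refine Polynomial.dvd_iff_isRoot.mpr ?_
    rw [Polynomial.IsRoot, ← map_one (starRingEnd ℂ), Polynomial.eval_map_apply]
    simp [hz]
  have e2 : A₂ = (X - 1) * (M : ℂ⟦X⟧) := by
    rw [hA₂, ← coe_comp_C_mul_X, hM]; simp
  have e3 : A₃ = (X - 1) * (M' : ℂ⟦X⟧) := by
    rw [hA₃, hA₂, ← coe_comp_C_mul_X, ← coe_map_conj, hM']; simp
  have e1 : (1 - C (ρ : ℂ) * X) * A₁ =
      ((N.comp (Polynomial.C (‖z‖ : ℂ) * Polynomial.X) : Polynomial ℂ) : ℂ⟦X⟧) := by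
    rw [coe_comp_C_mul_X, ← hA, map_mul, map_sub, map_one, map_mul, rescale_X]
    have : rescale (‖z‖ : ℂ) (C (q : ℂ)) = C (q : ℂ) := by
      ext n; rw [coeff_rescale, coeff_C]; split_ifs with h <;> simp [h]
    rw [this, ← mul_assoc, ← map_mul, hρ]
    push_cast
    rfl
  set N' := N.comp (Polynomial.C (‖z‖ : ℂ) * Polynomial.X)
  rcases hρ1.eq_or_lt with h1 | h1
  -- If `ρ = 1`, the double pole of `A₁ ^ 2` at `1` cancels against the zeros of `A₂` and `A₃`
  -- there. So `D` is a polynomial, whereas `coeff_pos` gives it nonzero coefficients of arbitrarily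
  -- large degree.
  · have hpoly : D = ((N' * N' * (M * M') : Polynomial ℂ) : ℂ⟦X⟧) := by
      have hne : (1 - X : ℂ⟦X⟧) ≠ 0 := by
        intro h
        have := congrArg (coeff 0) h
        simp at this
      have e1' : (1 - X : ℂ⟦X⟧) * A₁ = (N' : ℂ⟦X⟧) := by
        rw [← e1, h1]; simp
      refine mul_left_cancel₀ (mul_ne_zero hne hne) ?_
      rw [hD, e2, e3]
      push_cast
      rw [← e1']
      ring
    obtain ⟨k, hk, hpos⟩ := pos (z / ‖z‖) (by simp [hz0])
    have hk' : 0 < coeff k (H₁ + H₁ + (H₂ + H₃)) := by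
      rw [hcoeff]
      have h2 : (‖z‖ ^ k * g k + (z ^ k * coeff k G).re) =
          ‖z‖ ^ k * (g k + ((z / ‖z‖) ^ k * coeff k G).re) := by
        rw [mul_add, ← Complex.re_ofReal_mul, div_pow]
        congr 2
        have : (‖z‖ : ℂ) ≠ 0 := by exact_mod_cast hzn.ne'
        push_cast
        field_simp
      rw [h2]
      exact_mod_cast (by positivity : 0 < 2 * (‖z‖ ^ k * (g k + ((z / ‖z‖) ^ k * coeff k G).re)))
    set P := N' * N' * (M * M')
    have := lD.coeff_pos hD0 hnonneg hk hk' (P.natDegree + 1)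
    rw [hpoly, Polynomial.coeff_coe, Polynomial.coeff_eq_zero_of_natDegree_lt (by nlinarith)] at this
    exact lt_irrefl _ this
  -- If `ρ < 1`, the pole `1 / ρ` lies outside the unit disc, so `D` converges at radius one and
  -- keeps a zero at `1`.
  · obtain ⟨g', hg', hinv⟩ := exists_summableAt_mul_eq_one zero_le_one
      (1 - Polynomial.C (ρ : ℂ) * Polynomial.X)
      (fun h => by have := congrArg (Polynomial.coeff · 0) h; simp at this) (by
        intro w hw
        have hw' := (Polynomial.mem_roots'.mp hw).2
        simp only [Polynomial.IsRoot, Polynomial.eval_sub, Polynomial.eval_one,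
          Polynomial.eval_mul, Polynomial.eval_C, Polynomial.eval_X, sub_eq_zero] at hw'
        have : ρ * ‖w‖ = 1 := by
          have := congrArg norm hw'
          rw [norm_one, norm_mul, Complex.norm_real, Real.norm_of_nonneg hρ0.le] at this
          exact this.symm
        by_contra! hw1
        nlinarith [norm_nonneg w])
    have hinv' : (1 - C (ρ : ℂ) * X) * g' = 1 := by
      rwa [Polynomial.coe_sub, Polynomial.coe_one, Polynomial.coe_mul, Polynomial.coe_C,
        Polynomial.coe_X] at hinv
    set E : ℂ⟦X⟧ := ((N' * N' * ((1 - Polynomial.X) * M * M') : Polynomial ℂ) : ℂ⟦X⟧) * (g' * g')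
      with hE
    have hES : SummableAt 1 E := (summableAt_polynomial 1 _).mul (hg'.mul hg')
    have hDE : D = (1 - X) * E := by
      have hA₁ : A₁ = N' * g' := by
        rw [← e1, mul_right_comm, hinv', one_mul]
      rw [hD, e2, e3, hE, hA₁]
      push_cast
      ring
    -- The coefficients of `D = (1 - X) E` are the differences of those of `E`. Being non-negative,
    -- they keep the coefficients of `E` at or above the initial value `1`, although convergence
    -- forces them to tend to `0`.
    have hge : ∀ n, 1 ≤ (coeff n E).re := by
      intro n
      induction n with
      | zero =>
        have := hD0
        rw [hDE, coeff_zero_eq_constantCoeff_apply, map_mul] at this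
        simp only [map_sub, map_one, constantCoeff_X, sub_zero, one_mul] at this
        rw [coeff_zero_eq_constantCoeff_apply, this]
        simp
      | succ n ih =>
        have h2 := lD.coeff_nonneg hD0 hnonneg (n + 1)
        rw [hDE, sub_mul, one_mul, map_sub, coeff_succ_X_mul, Complex.nonneg_iff] at h2
        have := h2.1
        rw [Complex.sub_re] at this
        linarith
    have hlim := (Complex.continuous_re.tendsto _).comp hES.tendsto
    have h0 : (1 : ℝ) ≤ (0 : ℂ).re :=
      ge_of_tendsto' hlim fun n => by simpa using hge n
    simp at h0
    linarith

end Nonvanishing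

/-! ### Monic polynomials and prime powers over a finite field -/

section MonicPolynomials

open Polynomial UniqueFactorizationMonoid

variable {F : Type*} [Field F]

theorem pow_dvd_iff_le_count {f P : F[X]} [DecidableEq F] (hf : f ≠ 0) (hm : P.Monic)
    (hP : Irreducible P) (k : ℕ) : P ^ k ∣ f ↔ k ≤ (normalizedFactors f).count P := by
  rw [pow_dvd_iff_le_emultiplicity, le_emultiplicity_iff_replicate_le_normalizedFactors hP hf,
    Multiset.le_count_iff_replicate_le, hm.normalize_eq_self]

variable [Finite F]

theorem finite_setOf_natDegree_le (n : ℕ) : {f : F[X] | f.natDegree ≤ n}.Finite := by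
  have : Finite (degreeLT F (n + 1)) := Module.finite_of_finite F
  refine (Set.toFinite (degreeLT F (n + 1) : Set F[X])).subset fun f hf => ?_
  rw [SetLike.mem_coe, mem_degreeLT]
  exact (degree_le_of_natDegree_le hf).trans_lt (by exact_mod_cast Nat.lt_succ_self n)

variable (F) in
/-- The monic polynomials of degree `n`. -/
noncomputable def monics (n : ℕ) : Finset F[X] :=
  ((finite_setOf_natDegree_le n).subset
    (fun _ h => h.2.le : {f : F[X] | f.Monic ∧ f.natDegree = n} ⊆ _)).toFinset

theorem mem_monics {n : ℕ} {f : F[X]} : f ∈ monics F n ↔ f.Monic ∧ f.natDegree = n := by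
  simp [monics]

theorem monics_zero : monics F 0 = {1} := by
  ext f
  rw [mem_monics, Finset.mem_singleton]
  exact ⟨fun h => h.1.natDegree_eq_zero.mp h.2, by rintro rfl; simp⟩

variable (F) in
open Classical in
/-- The pairs `(P, k)` of a monic irreducible polynomial and a positive exponent such that `P ^ k`
has degree `n`. -/
noncomputable def primePowers (n : ℕ) : Finset (F[X] × ℕ) :=
  ((Finset.range (n + 1)).biUnion (monics F) ×ˢ Finset.range (n + 1)).filter fun x =>
    Irreducible x.1 ∧ 0 < x.2 ∧ x.2 * x.1.natDegree = n

theorem mem_primePowers {n : ℕ} {x : F[X] × ℕ} : x ∈ primePowers F n ↔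
    x.1.Monic ∧ Irreducible x.1 ∧ 0 < x.2 ∧ x.2 * x.1.natDegree = n := by
  simp only [primePowers, Finset.mem_filter, Finset.mem_product, Finset.mem_biUnion,
    Finset.mem_range, mem_monics]
  constructor
  · rintro ⟨⟨⟨j, -, hj⟩, -⟩, h⟩
    exact ⟨hj.1, h⟩
  · rintro ⟨hm, hi, hk, hn⟩
    have hd : 0 < x.1.natDegree := hi.natDegree_pos
    refine ⟨⟨⟨_, ?_, hm, rfl⟩, ?_⟩, hi, hk, hn⟩ <;> nlinarith

open Classical in
/-- The prime powers dividing `f`, each weighted by the degree of its prime, have total weight the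
degree of `f`. -/
theorem sum_natDegree_primePowers_dvd {n : ℕ} {f : F[X]} (hf : f ∈ monics F n) :
    ∑ x ∈ ((Finset.range (n + 1)).biUnion (primePowers F)).filter (fun x => x.1 ^ x.2 ∣ f),
      x.1.natDegree = n := by
  obtain ⟨hm, hn⟩ := mem_monics.mp hf
  have hf0 := hm.ne_zero
  -- A prime `P` contributes the powers `P ^ k` with `k` from `1` to its multiplicity in `f`.
  have h1 : ∑ x ∈ ((Finset.range (n + 1)).biUnion (primePowers F)).filter
      (fun x => x.1 ^ x.2 ∣ f), x.1.natDegree =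
      ∑ P ∈ (normalizedFactors f).toFinset,
        ∑ _k ∈ Finset.Icc 1 ((normalizedFactors f).count P), P.natDegree := by
    rw [Finset.sum_sigma']
    refine Finset.sum_bij' (fun x _ => ⟨x.1, x.2⟩) (fun x _ => (x.1, x.2)) ?_ ?_ ?_ ?_ ?_
    · intro x hx
      simp only [Finset.mem_filter, Finset.mem_biUnion, Finset.mem_range, mem_primePowers] at hx
      obtain ⟨⟨j, hj, hxm, hxi, hk, hxn⟩, hd⟩ := hx
      rw [pow_dvd_iff_le_count hf0 hxm hxi] at hd
      simp only [Finset.mem_sigma, Multiset.mem_toFinset, Finset.mem_Icc]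
      exact ⟨Multiset.count_pos.mp (by omega), hk, hd⟩
    · intro x hx
      simp only [Finset.mem_sigma, Multiset.mem_toFinset, Finset.mem_Icc] at hx
      obtain ⟨hx, hk, hd⟩ := hx
      have hxi := irreducible_of_normalized_factor _ hx
      have hxm : x.1.Monic := by
        rw [← normalize_normalized_factor _ hx]
        exact monic_normalize hxi.ne_zero
      rw [← pow_dvd_iff_le_count hf0 hxm hxi] at hd
      simp only [Finset.mem_filter, Finset.mem_biUnion, Finset.mem_range, mem_primePowers]
      refine ⟨⟨_, ?_, hxm, hxi, hk, rfl⟩, hd⟩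
      have := natDegree_le_of_dvd hd hf0
      rw [natDegree_pow] at this
      omega
    · intro x _; rfl
    · intro x _; rfl
    · intro x _; rfl
  rw [h1]
  simp only [Finset.sum_const, Nat.card_Icc, Nat.add_sub_cancel, smul_eq_mul]
  have h2 : (normalizedFactors f).prod = f := by
    rw [prod_normalizedFactors_eq hf0, hm.normalize_eq_self]
  have h3 : ((normalizedFactors f).map natDegree).sum = n := by
    rw [← hn, ← natDegree_multiset_prod _ (zero_notMem_normalizedFactors f), h2]
  rw [← h3, Finset.sum_multiset_map_count]
  simp

/-- The convolution identity behind the logarithmic derivative of an `L`-function. -/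
theorem sum_antidiagonal_monics_primePowers {M : Type*} [CommSemiring M] (θ : F[X] →* M) (n : ℕ) :
    ∑ p ∈ Finset.HasAntidiagonal.antidiagonal n, (∑ h ∈ monics F p.1, θ h) *
      (∑ x ∈ primePowers F p.2, (x.1.natDegree : M) * θ (x.1 ^ x.2)) =
    n * ∑ f ∈ monics F n, θ f := by
  classical
  have h1 : ∀ f ∈ monics F n, (n : M) * θ f = ∑ x ∈ ((Finset.range (n + 1)).biUnion
      (primePowers F)).filter (fun x => x.1 ^ x.2 ∣ f), (x.1.natDegree : M) * θ f := by
    intro f hf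
    rw [← Finset.sum_mul, ← Nat.cast_sum, sum_natDegree_primePowers_dvd hf]
  rw [Finset.mul_sum, Finset.sum_congr rfl h1]
  simp_rw [Finset.sum_mul_sum, ← Finset.sum_product']
  rw [Finset.sum_sigma', Finset.sum_sigma']
  -- A pair of `h` and `P ^ k` corresponds to `f = h P ^ k` together with its divisor `P ^ k`.
  refine Finset.sum_bij' (fun y _ => ⟨y.2.1 * y.2.2.1 ^ y.2.2.2, y.2.2⟩)
    (fun z _ => ⟨(n - z.2.2 * z.2.1.natDegree, z.2.2 * z.2.1.natDegree),
      (z.1 /ₘ z.2.1 ^ z.2.2, z.2)⟩) ?_ ?_ ?_ ?_ ?_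
  · rintro ⟨⟨i, j⟩, h, x⟩ hy
    simp only [Finset.mem_sigma, Finset.HasAntidiagonal.mem_antidiagonal, Finset.mem_product,
      mem_monics, mem_primePowers, Finset.mem_filter, Finset.mem_biUnion, Finset.mem_range] at hy ⊢
    obtain ⟨hij, ⟨hm, hd⟩, hxm, hxi, hk, hx⟩ := hy
    refine ⟨⟨hm.mul (hxm.pow _), ?_⟩, ⟨j, by omega, hxm, hxi, hk, hx⟩, dvd_mul_left _ _⟩
    rw [hm.natDegree_mul (hxm.pow _), hd, natDegree_pow, hx, hij]
  · rintro ⟨f, x⟩ hz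
    simp only [Finset.mem_sigma, Finset.HasAntidiagonal.mem_antidiagonal, Finset.mem_product,
      mem_monics, mem_primePowers, Finset.mem_filter, Finset.mem_biUnion, Finset.mem_range] at hz ⊢
    obtain ⟨⟨hm, hd⟩, ⟨j, hj, hxm, hxi, hk, hx⟩, hdvd⟩ := hz
    have hle := natDegree_le_of_dvd hdvd hm.ne_zero
    rw [natDegree_pow, hd] at hle
    refine ⟨by omega, ⟨?_, ?_⟩, hxm, hxi, hk, trivial⟩
    · refine (hxm.pow x.2).of_mul_monic_left ?_
      obtain ⟨h, rfl⟩ := hdvd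
      rwa [mul_divByMonic_cancel_left _ (hxm.pow _)]
    · rw [natDegree_divByMonic _ (hxm.pow _), natDegree_pow, hd]
  · rintro ⟨⟨i, j⟩, h, x⟩ hy
    simp only [Finset.mem_sigma, Finset.HasAntidiagonal.mem_antidiagonal, Finset.mem_product,
      mem_monics, mem_primePowers] at hy
    obtain ⟨hij, ⟨hm, hd⟩, hxm, hxi, hk, hx⟩ := hy
    have : (h * x.1 ^ x.2) /ₘ x.1 ^ x.2 = h := by
      rw [mul_comm, mul_divByMonic_cancel_left _ (hxm.pow _)]
    simp only [hx, this]
    have : n - j = i := by omega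
    rw [this]
  · rintro ⟨f, x⟩ hz
    simp only [Finset.mem_sigma, mem_monics, mem_primePowers, Finset.mem_filter,
      Finset.mem_biUnion, Finset.mem_range] at hz
    obtain ⟨⟨hm, hd⟩, ⟨j, hj, hxm, hxi, hk, hx⟩, hdvd⟩ := hz
    have : f /ₘ x.1 ^ x.2 * x.1 ^ x.2 = f := by
      obtain ⟨h, rfl⟩ := hdvd
      rw [mul_divByMonic_cancel_left _ (hxm.pow _), mul_comm]
    simp only [this]
  · rintro ⟨⟨i, j⟩, h, x⟩ hy
    simp only [map_mul]
    ring

end MonicPolynomials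

/-! ### Equidistribution in residue classes and counting -/

section LSeries

open Polynomial

variable {F : Type*} [Field F]

theorem degree_modByMonicHom_lt {a : F[X]} (ha : a.Monic) (c : AdjoinRoot a) :
    (AdjoinRoot.modByMonicHom ha c).degree < a.degree := by
  obtain ⟨f, rfl⟩ := AdjoinRoot.mk_surjective c
  rw [AdjoinRoot.modByMonicHom_mk]
  exact degree_modByMonic_lt _ ha

theorem natCard_adjoinRoot {a : F[X]} (ha : a.Monic) :
    Nat.card (AdjoinRoot a) = Nat.card F ^ a.natDegree := by
  have := ha.finite_adjoinRoot
  have := ha.free_adjoinRoot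
  rw [Module.natCard_eq_pow_finrank (K := F), (AdjoinRoot.powerBasis' ha).finrank]
  rfl

variable [Finite F]

/-- Monic polynomials of a fixed degree that is at least that of the modulus are equidistributed
among the residue classes. -/
theorem sum_monics_mk {a : F[X]} (ha : a.Monic) [Fintype (AdjoinRoot a)] {M : Type*}
    [AddCommMonoid M] (φ : AdjoinRoot a → M) (k : ℕ) :
    ∑ f ∈ monics F (a.natDegree + k), φ (AdjoinRoot.mk a f) =
      (monics F k).card • ∑ c, φ c := by
  rw [← Finset.sum_const, ← Finset.sum_product']
  have key : ∀ (h : F[X]) (c : AdjoinRoot a), h.Monic →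
      (AdjoinRoot.modByMonicHom ha c).degree < (a * h).degree := by
    intro h c hh
    refine (degree_modByMonicHom_lt ha c).trans_le ?_
    exact degree_le_mul_left a hh.ne_zero
  have hmk : ∀ (h : F[X]) (c : AdjoinRoot a),
      AdjoinRoot.mk a (AdjoinRoot.modByMonicHom ha c + a * h) = c := by
    intro h c
    rw [map_add, AdjoinRoot.mk_leftInverse ha c, map_mul, AdjoinRoot.mk_self, zero_mul, add_zero]
  -- Division with remainder: `f` corresponds to its quotient, monic of degree `k`, and its residue
  -- class.
  refine Finset.sum_bij' (fun f _ => (f /ₘ a, AdjoinRoot.mk a f))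
    (fun x _ => AdjoinRoot.modByMonicHom ha x.2 + a * x.1) ?_ ?_ ?_ ?_ ?_
  · intro f hf
    obtain ⟨hm, hd⟩ := mem_monics.mp hf
    simp only [Finset.mem_product, Finset.mem_univ, and_true, mem_monics]
    have hle : a.degree ≤ f.degree := by
      rw [degree_eq_natDegree ha.ne_zero, degree_eq_natDegree hm.ne_zero, hd]
      exact_mod_cast Nat.le_add_right _ _
    refine ⟨?_, by rw [natDegree_divByMonic _ ha, hd]; omega⟩
    rw [Monic, leadingCoeff_divByMonic_of_monic ha hle, hm.leadingCoeff]
  · rintro ⟨h, c⟩ hx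
    simp only [Finset.mem_product, Finset.mem_univ, and_true, mem_monics] at hx
    rw [mem_monics]
    refine ⟨(ha.mul hx.1).add_of_right (key h c hx.1), ?_⟩
    rw [natDegree_add_eq_right_of_degree_lt (key h c hx.1), ha.natDegree_mul hx.1, hx.2]
  · intro f _
    simp only [AdjoinRoot.modByMonicHom_mk, modByMonic_add_div]
  · rintro ⟨h, c⟩ _
    simp only [hmk, Prod.mk.injEq, and_true]
    exact (div_modByMonic_unique h _ ha ⟨rfl, degree_modByMonicHom_lt ha c⟩).1
  · intro f _; rfl

/-- Equidistribution modulo `X` multiplies the number by `q` when the degree grows by one. -/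
theorem card_monics (n : ℕ) : (monics F n).card = Nat.card F ^ n := by
  induction n with
  | zero => simp [monics_zero]
  | succ n ih =>
    have := (monic_X (R := F)).finite_adjoinRoot
    have : Finite (AdjoinRoot (X : F[X])) := Module.finite_of_finite F
    have := Fintype.ofFinite (AdjoinRoot (X : F[X]))
    have h := sum_monics_mk (monic_X (R := F)) (fun _ => (1 : ℕ)) n
    rw [natDegree_X, add_comm] at h
    simp only [Finset.sum_const, smul_eq_mul, mul_one, Finset.card_univ] at h
    rw [h, ih, ← Nat.card_eq_fintype_card, natCard_adjoinRoot monic_X, natDegree_X, pow_one,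
      pow_succ]

/-- The weighted number of prime powers of degree `n`. -/
theorem sum_primePowers_natDegree (n : ℕ) :
    ∑ x ∈ primePowers F (n + 1), x.1.natDegree = Nat.card F ^ (n + 1) := by
  have h := fun n => sum_antidiagonal_monics_primePowers (F := F) (1 : F[X] →* ℕ) n
  simp only [MonoidHom.one_apply, Finset.sum_const, smul_eq_mul, mul_one, card_monics,
    Nat.cast_id] at h
  have h1 := h (n + 1)
  -- In the convolution identity for `n + 1` the first term is the required sum, and the others add
  -- up to `q` times the identity for `n`. What is left is `(n + 1) q ^ (n + 1) - n q ^ (n + 1)`.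
  rw [Finset.Nat.sum_antidiagonal_succ] at h1
  simp only [pow_succ (Nat.card F), pow_zero, one_mul, mul_right_comm _ (Nat.card F)] at h1
  rw [← Finset.sum_mul, h n] at h1
  rw [pow_succ]
  linarith

end LSeries

/-! ### Characters modulo a polynomial and their `L`-functions -/

section Characters

open Polynomial

variable {F : Type*} [Field F]

theorem MulChar.norm_apply_of_isUnit {M : Type*} [CommMonoid M] [Finite M] (χ : MulChar M ℂ)
    {x : M} (hx : IsUnit x) : ‖χ x‖ = 1 := by
  refine Complex.norm_eq_one_of_pow_eq_one (n := Nat.card Mˣ) ?_ Nat.card_pos.ne'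
  obtain ⟨u, rfl⟩ := hx
  rw [← map_pow, ← Units.val_pow_eq_pow_val, pow_card_eq_one', Units.val_one, map_one]

/-- Some character separates `x` from `1`, and multiplying by it permutes the characters. -/
theorem MulChar.sum_apply_eq_zero {M : Type*} [CommMonoid M] [Finite M]
    [Fintype (MulChar M ℂ)] {x : M} (hx : x ≠ 1) : ∑ χ : MulChar M ℂ, χ x = 0 := by
  have : NeZero (Monoid.exponent Mˣ) := ⟨Monoid.exponent_ne_zero_of_finite⟩
  obtain ⟨χ, hχ⟩ := MulChar.exists_apply_ne_one_of_hasEnoughRootsOfUnity M ℂ hx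
  refine eq_zero_of_mul_eq_self_left hχ ?_
  simp only [Finset.mul_sum, ← MulChar.mul_apply]
  exact Fintype.sum_bijective _ (Group.mulLeft_bijective χ) _ _ fun χ' => rfl

theorem isUnit_mk_of_isCoprime {a f : F[X]} (h : IsCoprime a f) :
    IsUnit (AdjoinRoot.mk a f) := by
  have := h.map (AdjoinRoot.mk a)
  rwa [AdjoinRoot.mk_self, isCoprime_zero_left] at this

variable [Finite F]

/-- The coefficients of the `L`-function of a character modulo `a`. -/
noncomputable def lCoeff (a : F[X]) (χ : MulChar (AdjoinRoot a) ℂ) (n : ℕ) : ℂ :=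
  ∑ f ∈ monics F n, χ (AdjoinRoot.mk a f)

/-- The character sum over prime powers. -/
noncomputable def psi (a : F[X]) (χ : MulChar (AdjoinRoot a) ℂ) (n : ℕ) : ℂ :=
  ∑ x ∈ primePowers F n, (x.1.natDegree : ℂ) * χ (AdjoinRoot.mk a (x.1 ^ x.2))

theorem isLogDeriv_lCoeff (a : F[X]) (χ : MulChar (AdjoinRoot a) ℂ) :
    IsLogDeriv (PowerSeries.mk (lCoeff a χ)) (PowerSeries.mk (psi a χ)) := by
  refine IsLogDeriv.of_coeff fun n => ?_
  rw [PowerSeries.coeff_mul, PowerSeries.coeff_mk]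
  simp only [PowerSeries.coeff_mk]
  exact (sum_antidiagonal_monics_primePowers
    ((χ : AdjoinRoot a →* ℂ).comp (AdjoinRoot.mk a : F[X] →* AdjoinRoot a)) n).symm

theorem lCoeff_zero (a : F[X]) (χ : MulChar (AdjoinRoot a) ℂ) : lCoeff a χ 0 = 1 := by
  simp [lCoeff, monics_zero]

theorem exists_coe_eq_of_coeff_eq_zero (f : PowerSeries ℂ) (m : ℕ)
    (h : ∀ n, m ≤ n → PowerSeries.coeff n f = 0) : ∃ p : ℂ[X], (p : PowerSeries ℂ) = f := by
  refine ⟨PowerSeries.trunc m f, PowerSeries.ext fun n => ?_⟩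
  rw [Polynomial.coeff_coe, PowerSeries.coeff_trunc]
  split_ifs with hn
  · rfl
  · exact (h n (not_lt.mp hn)).symm

variable {a : F[X]}

/-- The character sums over prime powers are `o(q ^ n)` for nontrivial characters. -/
theorem tendsto_psi (ha : a.Monic) (hd : 0 < a.natDegree) {χ : MulChar (AdjoinRoot a) ℂ}
    (hχ : χ ≠ 1) : Filter.Tendsto (fun n => psi a χ n * ((Nat.card F : ℝ)⁻¹ : ℝ) ^ n)
      Filter.atTop (nhds 0) := by
  classical
  have := ha.finite_adjoinRoot
  have hfin : Finite (AdjoinRoot a) := Module.finite_of_finite F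
  have := Fintype.ofFinite (AdjoinRoot a)
  set q : ℝ := (Nat.card F : ℝ) with hq
  have hq0 : 0 < q := by rw [hq]; exact_mod_cast Nat.card_pos
  -- From degree `deg a` on, the coefficients are multiples of the sum of `χ` over all classes,
  -- which vanishes.
  obtain ⟨L, hL⟩ := exists_coe_eq_of_coeff_eq_zero (PowerSeries.mk (lCoeff a χ)) a.natDegree (by
    intro n hn
    obtain ⟨k, rfl⟩ := Nat.exists_eq_add_of_le hn
    rw [PowerSeries.coeff_mk, lCoeff, sum_monics_mk ha (fun c => χ c), MulChar.sum_eq_zero_of_ne_one hχ,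
      smul_zero])
  -- For the trivial character these coefficients grow exactly by the factor `q`, so the only pole
  -- is simple and at `1 / q`.
  obtain ⟨N, hN⟩ := exists_coe_eq_of_coeff_eq_zero
    ((1 - PowerSeries.C (q : ℂ) * PowerSeries.X) * PowerSeries.mk (lCoeff a 1))
    (a.natDegree + 1) (by
    intro n hn
    obtain ⟨k, rfl⟩ := Nat.exists_eq_add_of_le hn
    rw [sub_mul, one_mul, map_sub, mul_assoc, PowerSeries.coeff_C_mul, PowerSeries.coeff_mk,
      show a.natDegree + 1 + k = a.natDegree + k + 1 by ring, PowerSeries.coeff_succ_X_mul,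
      PowerSeries.coeff_mk, lCoeff, lCoeff, add_assoc, sum_monics_mk ha (fun c => (1 : MulChar (AdjoinRoot a) ℂ) c),
      sum_monics_mk ha (fun c => (1 : MulChar (AdjoinRoot a) ℂ) c), card_monics, card_monics, hq, pow_succ]
    simp only [nsmul_eq_mul]
    push_cast
    ring)
  have hL0 : L.coeff 0 = 1 := by
    rw [← Polynomial.coeff_coe, hL, PowerSeries.coeff_mk, lCoeff_zero]
  have lL : IsLogDeriv L (PowerSeries.mk (psi a χ)) := hL ▸ isLogDeriv_lCoeff a χ
  have hroot : ∀ z ∈ L.roots, q⁻¹ < ‖z‖ := by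
    intro z hz
    refine inv_lt_norm_of_eval_eq_zero hq0 hN.symm
      (by rw [PowerSeries.coeff_mk, lCoeff_zero]) hL0 (isLogDeriv_lCoeff a 1) lL
      (g := fun n => ∑ x ∈ primePowers F n, (x.1.natDegree : ℝ) *
        if IsUnit (AdjoinRoot.mk a (x.1 ^ x.2)) then 1 else 0) ?_ ?_ ?_ (Polynomial.mem_roots'.mp hz).2
    · intro n
      rw [PowerSeries.coeff_mk, psi]
      push_cast
      refine Finset.sum_congr rfl fun x _ => ?_
      by_cases h : IsUnit (AdjoinRoot.mk a (x.1 ^ x.2))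
      · rw [MulChar.one_apply h, if_pos h]; simp
      · rw [MulChar.map_nonunit _ h, if_neg h]; simp
    · intro n
      rw [PowerSeries.coeff_mk, psi]
      refine norm_sum_le_of_le _ fun x _ => ?_
      rw [norm_mul, Complex.norm_natCast]
      refine mul_le_mul_of_nonneg_left ?_ (Nat.cast_nonneg _)
      split_ifs with h
      · exact (χ.norm_apply_of_isUnit h).le
      · rw [MulChar.map_nonunit _ h, norm_zero]
    · intro u hu
      have hterm : ∀ n, (∑ x ∈ primePowers F n, (x.1.natDegree : ℝ) *
          if IsUnit (AdjoinRoot.mk a (x.1 ^ x.2)) then 1 else 0) +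
          (u ^ n * PowerSeries.coeff n (PowerSeries.mk (psi a χ))).re =
          ∑ x ∈ primePowers F n, (x.1.natDegree : ℝ) *
            ((if IsUnit (AdjoinRoot.mk a (x.1 ^ x.2)) then 1 else 0) +
              (u ^ n * χ (AdjoinRoot.mk a (x.1 ^ x.2))).re) := by
        intro n
        rw [PowerSeries.coeff_mk, psi, Finset.mul_sum, Complex.re_sum, ← Finset.sum_add_distrib]
        refine Finset.sum_congr rfl fun x _ => ?_
        rw [mul_add, mul_left_comm, ← Complex.ofReal_natCast, Complex.re_ofReal_mul]
      have hterm0 : ∀ n, ∀ x ∈ primePowers F n, 0 ≤ (x.1.natDegree : ℝ) *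
            ((if IsUnit (AdjoinRoot.mk a (x.1 ^ x.2)) then 1 else 0) +
              (u ^ n * χ (AdjoinRoot.mk a (x.1 ^ x.2))).re) := by
        intro n x _
        refine mul_nonneg (Nat.cast_nonneg _) ?_
        split_ifs with h
        · have h1 := neg_le_abs (u ^ n * χ (AdjoinRoot.mk a (x.1 ^ x.2))).re
          have h2 := Complex.abs_re_le_norm (u ^ n * χ (AdjoinRoot.mk a (x.1 ^ x.2)))
          rw [norm_mul, norm_pow, hu, one_pow, one_mul, χ.norm_apply_of_isUnit h] at h2
          linarith
        · rw [MulChar.map_nonunit _ h]; simp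
      -- A prime factor of `a X + 1` is prime to `a`, so `χ` takes a value of norm one on it.
      obtain ⟨P, hPm, hPi, hPd⟩ := Polynomial.exists_monic_irreducible_factor (a * X + 1) (by
        refine Polynomial.not_isUnit_of_natDegree_pos _ ?_
        rw [← C_1, natDegree_add_C, natDegree_mul_X ha.ne_zero]
        omega)
      have hco : IsCoprime a P := by
        obtain ⟨s, hs⟩ := hPd
        exact ⟨-X, s, by linear_combination -hs⟩
      have hunit := isUnit_mk_of_isCoprime hco
      have hPpos : 0 < P.natDegree := hPi.natDegree_pos
      set w : ℂ := u ^ P.natDegree * χ (AdjoinRoot.mk a P) with hw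
      have hwn : ‖w‖ = 1 := by
        rw [hw, norm_mul, norm_pow, hu, one_pow, one_mul, χ.norm_apply_of_isUnit hunit]
      have hmain : ∀ k, 0 < k → 0 < 1 + (w ^ k).re → ∃ k, 0 < k ∧ 0 < (∑ x ∈ primePowers F k,
          (x.1.natDegree : ℝ) * if IsUnit (AdjoinRoot.mk a (x.1 ^ x.2)) then 1 else 0) +
          (u ^ k * PowerSeries.coeff k (PowerSeries.mk (psi a χ))).re := by
        intro k hk hpos
        refine ⟨k * P.natDegree, Nat.mul_pos hk hPpos, ?_⟩
        rw [hterm]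
        refine Finset.sum_pos' (hterm0 _) ⟨(P, k), mem_primePowers.mpr ⟨hPm, hPi, hk, rfl⟩, ?_⟩
        simp only
        rw [map_pow, if_pos (hunit.pow k), map_pow, mul_comm k, pow_mul, ← mul_pow]
        exact mul_pos (by exact_mod_cast hPpos) hpos
      by_cases h1 : 0 < 1 + w.re
      · exact hmain 1 one_pos (by rwa [pow_one])
      -- Since `‖w‖ = 1`, the failure of `0 < 1 + Re w` means `w = -1`, and then the square of `P`
      -- serves.
      · refine hmain 2 two_pos ?_
        have hsq := Complex.sq_norm w
        rw [Complex.normSq_apply, hwn] at hsq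
        have : (w ^ 2).re = w.re * w.re - w.im * w.im := by rw [sq, Complex.mul_re]
        rw [this]
        nlinarith
  obtain ⟨g, hg, hLg⟩ := exists_summableAt_mul_eq_one (inv_nonneg.mpr hq0.le) L
    (by rintro rfl; simp at hL0) hroot
  -- This is `X L' / L`, which converges absolutely at radius `1 / q` because `L` has no zero in
  -- that closed disc.
  have hpsi : PowerSeries.mk (psi a χ) = ((X * derivative L : ℂ[X]) : PowerSeries ℂ) * g := by
    have h1 : PowerSeries.X * PowerSeries.derivative ℂ (L : PowerSeries ℂ) =
      (L : PowerSeries ℂ) * PowerSeries.mk (psi a χ) := lL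
    rw [PowerSeries.derivative_coe] at h1
    rw [Polynomial.coe_mul, Polynomial.coe_X, h1, mul_right_comm, hLg, one_mul]
  have hS : SummableAt q⁻¹ (PowerSeries.mk (psi a χ)) := by
    rw [hpsi]; exact (summableAt_polynomial _ _).mul hg
  simpa using hS.tendsto

end Characters

/-! ### Dirichlet's theorem with prescribed degree -/

section Dirichlet

open Polynomial Filter

variable {F : Type*} [Field F] [Finite F]

/-- The difference comes from powers of the primes dividing `a`. Each such prime has at most one
power of a given degree, so their degrees bound it. -/
theorem exists_norm_psi_one_sub_le {a : F[X]} (ha : a.Monic) :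
    ∃ K : ℝ, ∀ n, ‖psi a 1 (n + 1) - (Nat.card F : ℂ) ^ (n + 1)‖ ≤ K := by
  classical
  refine ⟨∑ P ∈ (Finset.range (a.natDegree + 1)).biUnion (monics F), (P.natDegree : ℝ),
    fun n => ?_⟩
  have h1 : psi a 1 (n + 1) - (Nat.card F : ℂ) ^ (n + 1) =
      -((∑ x ∈ (primePowers F (n + 1)).filter fun x => ¬ IsUnit (AdjoinRoot.mk a (x.1 ^ x.2)),
        x.1.natDegree : ℕ) : ℂ) := by
    have h := sum_primePowers_natDegree (F := F) n
    rw [← Finset.sum_filter_add_sum_filter_not _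
      (fun x => IsUnit (AdjoinRoot.mk a (x.1 ^ x.2)))] at h
    rw [← Nat.cast_pow, ← h, psi, ← Finset.sum_filter_add_sum_filter_not _
      (fun x => IsUnit (AdjoinRoot.mk a (x.1 ^ x.2)))]
    have e1 : ∑ x ∈ (primePowers F (n + 1)).filter (fun x => IsUnit (AdjoinRoot.mk a (x.1 ^ x.2))),
        (x.1.natDegree : ℂ) * (1 : MulChar (AdjoinRoot a) ℂ) (AdjoinRoot.mk a (x.1 ^ x.2)) =
        ∑ x ∈ (primePowers F (n + 1)).filter (fun x => IsUnit (AdjoinRoot.mk a (x.1 ^ x.2))),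
          (x.1.natDegree : ℂ) :=
      Finset.sum_congr rfl fun x hx => by
        rw [MulChar.one_apply (Finset.mem_filter.mp hx).2, mul_one]
    have e2 : ∑ x ∈ (primePowers F (n + 1)).filter (fun x => ¬IsUnit (AdjoinRoot.mk a (x.1 ^ x.2))),
        (x.1.natDegree : ℂ) * (1 : MulChar (AdjoinRoot a) ℂ) (AdjoinRoot.mk a (x.1 ^ x.2)) = 0 :=
      Finset.sum_eq_zero fun x hx => by
        rw [MulChar.map_nonunit _ (Finset.mem_filter.mp hx).2, mul_zero]
    rw [e1, e2]
    push_cast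
    ring
  rw [h1, norm_neg, Complex.norm_natCast, ← Nat.cast_sum, Nat.cast_le]
  rw [← Finset.sum_image (s := (primePowers F (n + 1)).filter fun x =>
    ¬ IsUnit (AdjoinRoot.mk a (x.1 ^ x.2))) (g := Prod.fst) (f := natDegree)]
  · refine Finset.sum_le_sum_of_subset fun P hP => ?_
    obtain ⟨x, hx, rfl⟩ := Finset.mem_image.mp hP
    obtain ⟨hx, hu⟩ := Finset.mem_filter.mp hx
    obtain ⟨hm, hi, -, -⟩ := mem_primePowers.mp hx
    by_cases h : x.1 ∣ a
    · rw [Finset.mem_biUnion]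
      exact ⟨_, Finset.mem_range.mpr (Nat.lt_succ_of_le (natDegree_le_of_dvd h ha.ne_zero)),
        mem_monics.mpr ⟨hm, rfl⟩⟩
    · refine absurd ?_ hu
      rw [map_pow]
      exact (isUnit_mk_of_isCoprime (hi.coprime_iff_not_dvd.mpr h).symm).pow _
  · intro x hx y hy (hxy : x.1 = y.1)
    have h1 := mem_primePowers.mp (Finset.mem_filter.mp hx).1
    have h2 := mem_primePowers.mp (Finset.mem_filter.mp hy).1
    refine Prod.ext hxy (Nat.eq_of_mul_eq_mul_right h1.2.1.natDegree_pos ?_)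
    rw [h1.2.2.2, hxy, h2.2.2.2]

theorem tendsto_psi_one {a : F[X]} (ha : a.Monic) :
    Tendsto (fun n => psi a 1 n * ((Nat.card F : ℝ)⁻¹ : ℝ) ^ n) atTop (nhds 1) := by
  have hq1 : 1 < (Nat.card F : ℝ) := by exact_mod_cast Finite.one_lt_card
  rw [← tendsto_add_atTop_iff_nat 1, tendsto_iff_norm_sub_tendsto_zero]
  obtain ⟨K, hK⟩ := exists_norm_psi_one_sub_le ha
  have hlim : Tendsto (fun n : ℕ => K * (Nat.card F : ℝ)⁻¹ ^ (n + 1)) atTop (nhds 0) := by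
    have h := (tendsto_pow_atTop_nhds_zero_of_lt_one (inv_nonneg.mpr (by linarith))
      (inv_lt_one_of_one_lt₀ hq1)).const_mul K
    rw [mul_zero] at h
    exact (tendsto_add_atTop_iff_nat 1).mpr h
  refine squeeze_zero (fun _ => norm_nonneg _) (fun n => ?_) hlim
  have hq0 : (Nat.card F : ℂ) ≠ 0 := by exact_mod_cast Nat.card_pos.ne'
  have : psi a 1 (n + 1) * (((Nat.card F : ℝ)⁻¹ : ℝ) : ℂ) ^ (n + 1) - 1 =
      (psi a 1 (n + 1) - (Nat.card F : ℂ) ^ (n + 1)) * (((Nat.card F : ℝ)⁻¹ : ℝ) : ℂ) ^ (n + 1) := by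
    rw [sub_mul, ← mul_pow]
    push_cast
    rw [mul_inv_cancel₀ hq0, one_pow]
  rw [this, norm_mul, norm_pow, Complex.norm_real, Real.norm_of_nonneg (by positivity)]
  exact mul_le_mul_of_nonneg_right (hK n) (by positivity)

/-- Proper prime powers are negligible. -/
theorem sum_proper_primePowers_le (n : ℕ) :
    ((∑ x ∈ (primePowers F n).filter (fun x => 2 ≤ x.2), x.1.natDegree : ℕ) : ℝ) ≤
      2 * ((n : ℝ) ^ 2 * √(Nat.card F) ^ n) := by
  classical
  have hq1 : 1 ≤ Nat.card F := Nat.card_pos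
  have hmem : ∀ x ∈ (primePowers F n).filter (fun x => 2 ≤ x.2), x.1.natDegree ≤ n ∧
      x.1 ∈ (Finset.range (n / 2 + 1)).biUnion (monics F) := by
    intro x hx
    obtain ⟨hx, h2⟩ := Finset.mem_filter.mp hx
    obtain ⟨hm, hi, -, hn⟩ := mem_primePowers.mp hx
    have : 2 * x.1.natDegree ≤ n := hn ▸ Nat.mul_le_mul_right _ h2
    refine ⟨by omega, Finset.mem_biUnion.mpr ⟨_, Finset.mem_range.mpr ?_, mem_monics.mpr ⟨hm, rfl⟩⟩⟩
    omega
  -- The base of a proper power has degree at most `n / 2` and determines the exponent, so it is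
  -- enough to count bases.
  have hcard : ((primePowers F n).filter (fun x => 2 ≤ x.2)).card ≤
      (n / 2 + 1) * Nat.card F ^ (n / 2) := by
    refine (Finset.card_le_card_of_injOn (t := (Finset.range (n / 2 + 1)).biUnion (monics F))
      Prod.fst (fun x hx => (hmem x hx).2) ?_).trans ?_
    · intro x hx y hy (hxy : x.1 = y.1)
      have h1 := mem_primePowers.mp (Finset.mem_filter.mp hx).1
      have h2 := mem_primePowers.mp (Finset.mem_filter.mp hy).1
      refine Prod.ext hxy (Nat.eq_of_mul_eq_mul_right h1.2.1.natDegree_pos ?_)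
      rw [h1.2.2.2, hxy, h2.2.2.2]
    · refine (Finset.card_biUnion_le_card_mul _ _ (Nat.card F ^ (n / 2)) fun j hj => ?_).trans ?_
      · rw [card_monics]
        exact Nat.pow_le_pow_right hq1 (Nat.lt_succ_iff.mp (Finset.mem_range.mp hj))
      · rw [Finset.card_range]
  have h1 : ∑ x ∈ (primePowers F n).filter (fun x => 2 ≤ x.2), x.1.natDegree ≤
      ((n / 2 + 1) * Nat.card F ^ (n / 2)) * n :=
    (Finset.sum_le_card_nsmul _ _ n fun x hx => (hmem x hx).1).trans
      (Nat.mul_le_mul_right _ hcard)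
  have h2 : ((Nat.card F ^ (n / 2) : ℕ) : ℝ) ≤ √(Nat.card F) ^ n := by
    have hs : 1 ≤ √(Nat.card F : ℝ) := Real.one_le_sqrt.mpr (by exact_mod_cast hq1)
    calc ((Nat.card F ^ (n / 2) : ℕ) : ℝ) = √(Nat.card F) ^ (2 * (n / 2)) := by
          rw [pow_mul, Real.sq_sqrt (Nat.cast_nonneg _), Nat.cast_pow]
      _ ≤ _ := pow_le_pow_right₀ hs (by omega)
  have h3 : (n / 2 + 1) * n ≤ 2 * n ^ 2 := by
    rcases Nat.eq_zero_or_pos n with rfl | hn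
    · simp
    · have : n / 2 + 1 ≤ 2 * n := by omega
      nlinarith
  calc ((∑ x ∈ (primePowers F n).filter (fun x => 2 ≤ x.2), x.1.natDegree : ℕ) : ℝ)
      ≤ ((((n / 2 + 1) * Nat.card F ^ (n / 2)) * n : ℕ) : ℝ) := by exact_mod_cast h1
    _ = (((n / 2 + 1) * n : ℕ) : ℝ) * ((Nat.card F ^ (n / 2) : ℕ) : ℝ) := by push_cast; ring
    _ ≤ ((2 * n ^ 2 : ℕ) : ℝ) * √(Nat.card F) ^ n :=
        mul_le_mul (by exact_mod_cast h3) h2 (Nat.cast_nonneg _) (Nat.cast_nonneg _)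
    _ = _ := by push_cast; ring

theorem tendsto_sum_proper_primePowers :
    Tendsto (fun n => ((∑ x ∈ (primePowers F n).filter (fun x => 2 ≤ x.2), x.1.natDegree : ℕ) : ℝ) *
      (Nat.card F : ℝ)⁻¹ ^ n) atTop (nhds 0) := by
  have hq1 : 1 < (Nat.card F : ℝ) := by exact_mod_cast Finite.one_lt_card
  have hs : 1 < √(Nat.card F : ℝ) := by rwa [Real.lt_sqrt zero_le_one, one_pow]
  have hlim := (tendsto_pow_const_mul_const_pow_of_abs_lt_one 2 (r := (√(Nat.card F : ℝ))⁻¹) (by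
    rw [abs_of_nonneg (by positivity)]
    exact inv_lt_one_of_one_lt₀ hs)).const_mul 2
  rw [mul_zero] at hlim
  refine squeeze_zero (fun _ => by positivity) (fun n => ?_) hlim
  refine (mul_le_mul_of_nonneg_right (sum_proper_primePowers_le n) (by positivity)).trans_eq ?_
  have : (√(Nat.card F : ℝ))⁻¹ = √(Nat.card F : ℝ) * (Nat.card F : ℝ)⁻¹ := by
    have h := Real.mul_self_sqrt (Nat.cast_nonneg (α := ℝ) (Nat.card F))
    have h0 : √(Nat.card F : ℝ) ≠ 0 := by positivity
    have h1 : (Nat.card F : ℝ) ≠ 0 := by positivity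
    field_simp
    rw [sq, h]
  rw [this, mul_pow]
  ring

/-- The analogue of Dirichlet's theorem for polynomials over a finite field: a residue class prime
to the modulus contains monic irreducible polynomials of every sufficiently large degree. -/
theorem exists_monic_irreducible_natDegree_eq {a c : F[X]} (ha : a.Monic) (hd : 0 < a.natDegree)
    (hc : IsCoprime a c) : ∃ N, ∀ n, N ≤ n → ∃ P : F[X], P.Monic ∧ Irreducible P ∧
      P.natDegree = n ∧ a ∣ P - c := by
  classical
  have := ha.finite_adjoinRoot
  have hfin : Finite (AdjoinRoot a) := Module.finite_of_finite F
  have := Fintype.ofFinite (MulChar (AdjoinRoot a) ℂ)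
  obtain ⟨u, hu⟩ := isUnit_mk_of_isCoprime hc
  set T : ℕ → ℕ := fun n => ∑ x ∈ (primePowers F n).filter
    (fun x => AdjoinRoot.mk a (x.1 ^ x.2) = AdjoinRoot.mk a c), x.1.natDegree with hT
  set Φ := Fintype.card (MulChar (AdjoinRoot a) ℂ) with hΦ
  -- Orthogonality: summing over all characters picks out the prime powers in the class of `c`.
  have horth : ∀ n, ∑ χ : MulChar (AdjoinRoot a) ℂ, χ (u⁻¹ : (AdjoinRoot a)ˣ) * psi a χ n =
      (Φ : ℂ) * T n := by
    intro n
    simp only [psi, Finset.mul_sum]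
    simp only [hT]
    rw [Finset.sum_comm, Finset.sum_filter]
    push_cast
    rw [Finset.mul_sum]
    refine Finset.sum_congr rfl fun x _ => ?_
    have e : ∀ χ : MulChar (AdjoinRoot a) ℂ, χ (u⁻¹ : (AdjoinRoot a)ˣ) *
        ((x.1.natDegree : ℂ) * χ (AdjoinRoot.mk a (x.1 ^ x.2))) =
        (x.1.natDegree : ℂ) * χ ((u⁻¹ : (AdjoinRoot a)ˣ) * AdjoinRoot.mk a (x.1 ^ x.2)) := by
      intro χ; rw [map_mul]; ring
    simp only [e]
    rw [← Finset.mul_sum]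
    split_ifs with h
    · rw [h, ← hu, Units.inv_mul]
      simp [hΦ, mul_comm]
    · rw [MulChar.sum_apply_eq_zero, mul_zero]
      · simp
      · intro h1
        apply h
        rw [← hu, ← Units.inv_mul_eq_one.mp h1]
  have hlim : Tendsto (fun n => (Φ : ℂ) * T n * ((Nat.card F : ℝ)⁻¹ : ℝ) ^ n) atTop (nhds 1) := by
    have h := tendsto_finsetSum (Finset.univ : Finset (MulChar (AdjoinRoot a) ℂ))
      (f := fun χ n => χ (u⁻¹ : (AdjoinRoot a)ˣ) * (psi a χ n * ((Nat.card F : ℝ)⁻¹ : ℝ) ^ n))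
      (a := fun χ => if χ = 1 then 1 else 0) (x := atTop) (by
        intro χ _
        by_cases hχ : χ = 1
        · rw [if_pos hχ, hχ]
          have := (tendsto_psi_one ha).const_mul ((1 : MulChar (AdjoinRoot a) ℂ) (u⁻¹ : (AdjoinRoot a)ˣ))
          rw [mul_one] at this
          rwa [MulChar.one_apply_coe] at this ⊢
        · rw [if_neg hχ]
          simpa using (tendsto_psi ha hd hχ).const_mul (χ (u⁻¹ : (AdjoinRoot a)ˣ)))
    rw [Finset.sum_ite_eq' Finset.univ, if_pos (Finset.mem_univ _)] at h
    refine h.congr fun n => ?_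
    rw [← horth, Finset.sum_mul]
    exact Finset.sum_congr rfl fun χ _ => by ring
  have hlim' : Tendsto (fun n => (Φ : ℝ) * T n * (Nat.card F : ℝ)⁻¹ ^ n) atTop (nhds 1) := by
    have h := (Complex.continuous_re.tendsto _).comp hlim
    rw [Complex.one_re] at h
    refine h.congr fun n => ?_
    simp only [Function.comp]
    rw [← Complex.ofReal_re ((Φ : ℝ) * T n * (Nat.card F : ℝ)⁻¹ ^ n)]
    push_cast
    rfl
  have hlim2 := (tendsto_sum_proper_primePowers (F := F)).const_mul (Φ : ℝ)
  rw [mul_zero] at hlim2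
  have hev := (hlim'.eventually (lt_mem_nhds (by norm_num : (1 / 2 : ℝ) < 1))).and
    (hlim2.eventually (gt_mem_nhds (by norm_num : (0 : ℝ) < 1 / 2)))
  obtain ⟨N, hN⟩ := eventually_atTop.mp hev
  refine ⟨N, fun n hn => ?_⟩
  by_contra! hno
  obtain ⟨h1, h2⟩ := hN n hn
  -- Without an irreducible of degree `n` in the class, `T n` counts proper prime powers only. After
  -- normalisation these tend to `0`, while `Φ * T n` tends to `1`.
  have hle : T n ≤ ∑ x ∈ (primePowers F n).filter (fun x => 2 ≤ x.2), x.1.natDegree := by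
    refine Finset.sum_le_sum_of_subset fun x hx => ?_
    obtain ⟨hx, hxc⟩ := Finset.mem_filter.mp hx
    obtain ⟨hm, hi, hk, hdeg⟩ := mem_primePowers.mp hx
    refine Finset.mem_filter.mpr ⟨hx, ?_⟩
    by_contra! hlt
    have hk1 : x.2 = 1 := by omega
    rw [hk1, one_mul] at hdeg
    rw [hk1, pow_one, AdjoinRoot.mk_eq_mk] at hxc
    exact hno x.1 hm hi hdeg hxc
  have hle' : (Φ : ℝ) * T n * (Nat.card F : ℝ)⁻¹ ^ n ≤ Φ * (((∑ x ∈ (primePowers F n).filter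
      (fun x => 2 ≤ x.2), x.1.natDegree : ℕ) : ℝ) * (Nat.card F : ℝ)⁻¹ ^ n) := by
    rw [← mul_assoc]
    gcongr
  linarith

end Dirichlet

/-! ### Words in transvections of `3 × 3` matrices, up to the torus -/

section TransvectionWords

open Matrix

variable {R : Type*} [CommRing R]

/-- `A` is the product of at most `n` transvections and an invertible diagonal matrix. -/
def IsTorusWord (n : ℕ) (A : Matrix (Fin 3) (Fin 3) R) : Prop :=
  ∃ (l : List (TransvectionStruct (Fin 3) R)) (D : Fin 3 → Rˣ), l.length ≤ n ∧
    A = (l.map TransvectionStruct.toMatrix).prod * diagonal fun i => (D i : R)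

/-- The torus normalises each root subgroup, so diagonal factors can be collected on the right
without cost. -/
theorem diagonal_mul_transvection (D : Fin 3 → Rˣ) {i j : Fin 3} (hij : i ≠ j) (c : R) :
    (diagonal fun i => (D i : R)) * transvection i j c =
      transvection i j (D i * c * ↑(D j)⁻¹) * diagonal fun i => (D i : R) := by
  ext k l
  simp only [transvection, Matrix.add_apply, diagonal_mul, mul_diagonal, single_apply]
  by_cases h : i = k ∧ j = l
  · obtain ⟨rfl, rfl⟩ := h
    simp [Matrix.one_apply_ne hij]
  · by_cases hkl : k = l
    · subst hkl; simp [h]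
    · simp [h, Matrix.one_apply_ne hkl]

namespace IsTorusWord

variable {n m : ℕ} {A B : Matrix (Fin 3) (Fin 3) R}

theorem diagonal (D : Fin 3 → Rˣ) :
    IsTorusWord 0 (Matrix.diagonal fun i => (D i : R)) :=
  ⟨[], D, by simp, by simp⟩

theorem left (h : IsTorusWord n A) {i j : Fin 3} (hij : i ≠ j) (c : R) :
    IsTorusWord (n + 1) (transvection i j c * A) := by
  obtain ⟨l, D, hl, rfl⟩ := h
  exact ⟨⟨i, j, hij, c⟩ :: l, D, by simpa using hl, by simp [Matrix.mul_assoc]⟩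

theorem of_left {i j : Fin 3} (hij : i ≠ j) (c : R)
    (h : IsTorusWord n (transvection i j c * A)) : IsTorusWord (n + 1) A := by
  have := h.left hij (-c)
  rwa [← Matrix.mul_assoc, transvection_mul_transvection_same i j hij, neg_add_cancel,
    transvection_zero, Matrix.one_mul] at this

theorem diagonal_mul (h : IsTorusWord n A) (D : Fin 3 → Rˣ) :
    IsTorusWord n ((Matrix.diagonal fun i => (D i : R)) * A) := by
  obtain ⟨l, D', hl, rfl⟩ := h
  induction l generalizing n with
  | nil =>
    refine ⟨[], fun i => D i * D' i, hl, ?_⟩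
    simp
  | cons t l ih =>
    obtain ⟨k, rfl⟩ : ∃ k, n = k + 1 := ⟨n - 1, by simp at hl; omega⟩
    have := (ih (n := k) (by simpa using hl)).left t.hij (D t.i * t.c * ↑(D t.j)⁻¹)
    rw [← Matrix.mul_assoc, ← diagonal_mul_transvection D t.hij] at this
    simpa [TransvectionStruct.toMatrix, Matrix.mul_assoc] using this

theorem mul (hA : IsTorusWord n A) (hB : IsTorusWord m B) : IsTorusWord (n + m) (A * B) := by
  obtain ⟨l, D, hl, rfl⟩ := hA
  obtain ⟨l', D', hl', h⟩ := hB.diagonal_mul D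
  refine ⟨l ++ l', D', by simp; omega, ?_⟩
  rw [Matrix.mul_assoc, h]
  simp [Matrix.mul_assoc]

theorem transvection {i j : Fin 3} (hij : i ≠ j) (c : R) :
    IsTorusWord 1 (Matrix.transvection i j c) :=
  ⟨[⟨i, j, hij, c⟩], 1, by simp, by simp⟩

/-- The transvections of `A` are cancelled from the left one by one, each costing its inverse. This
expresses a matrix as a quotient of two of its powers. -/
theorem of_mul (hA : IsTorusWord n A) (hAB : IsTorusWord m (A * B)) :
    IsTorusWord (n + m) B := by
  obtain ⟨l, D, hl, rfl⟩ := hA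
  induction l generalizing n m with
  | nil =>
    obtain ⟨l', D', hl', h⟩ := hAB.diagonal_mul fun i => (D i)⁻¹
    refine ⟨l', D', by omega, ?_⟩
    rw [← h, ← Matrix.mul_assoc]
    simp
  | cons t l ih =>
    obtain ⟨k, rfl⟩ : ∃ k, n = k + 1 := ⟨n - 1, by simp at hl; omega⟩
    have h1 : IsTorusWord (m + 1)
        ((l.map TransvectionStruct.toMatrix).prod * (Matrix.diagonal fun i => (D i : R)) * B) := by
      refine of_left t.hij t.c ?_
      simpa [TransvectionStruct.toMatrix, Matrix.mul_assoc] using hAB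
    have := ih (n := k) (by simpa using hl) h1
    rwa [show k + 1 + m = k + (m + 1) by ring]

theorem transpose (h : IsTorusWord n A) : IsTorusWord n Aᵀ := by
  obtain ⟨l, D, hl, rfl⟩ := h
  rw [Matrix.transpose_mul, diagonal_transpose]
  refine diagonal_mul ?_ D
  induction l generalizing n with
  | nil => exact ⟨[], 1, by simp, by simp⟩
  | cons t l ih =>
    obtain ⟨k, rfl⟩ : ∃ k, n = k + 1 := ⟨n - 1, by simp at hl; omega⟩
    have := (ih (n := k) (by simpa using hl)).mul (IsTorusWord.transvection t.hij.symm t.c)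
    simpa [TransvectionStruct.toMatrix, Matrix.transvection, Matrix.transpose_mul] using this

section Operations

variable {a b c d e f g h i a' b' c' d' e' f' g' h' i' : R}

/-- In this lemma and its analogues below the new entries are variables tied by equations, so that
they can be given in simplified form, by means of relations such as the determinant. -/
theorem row₀₂ (t : R) (H : IsTorusWord n !![a', b', c'; d, e, f; g, h, i])
    (h₁ : a' = a + t * g) (h₂ : b' = b + t * h) (h₃ : c' = c + t * i) :
    IsTorusWord (n + 1) !![a, b, c; d, e, f; g, h, i] := by
  refine of_left (i := 0) (j := 2) (by decide) t ?_
  convert H using 1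
  ext k l
  fin_cases k <;> fin_cases l <;>
    simp [Matrix.transvection, Matrix.mul_apply, Fin.sum_univ_three, *]

theorem row₁₂ (t : R) (H : IsTorusWord n !![a, b, c; d', e', f'; g, h, i])
    (h₁ : d' = d + t * g) (h₂ : e' = e + t * h) (h₃ : f' = f + t * i) :
    IsTorusWord (n + 1) !![a, b, c; d, e, f; g, h, i] := by
  refine of_left (i := 1) (j := 2) (by decide) t ?_
  convert H using 1
  ext k l
  fin_cases k <;> fin_cases l <;>
    simp [Matrix.transvection, Matrix.mul_apply, Fin.sum_univ_three, *]

theorem row₀₁ (t : R) (H : IsTorusWord n !![a', b', c'; d, e, f; g, h, i])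
    (h₁ : a' = a + t * d) (h₂ : b' = b + t * e) (h₃ : c' = c + t * f) :
    IsTorusWord (n + 1) !![a, b, c; d, e, f; g, h, i] := by
  refine of_left (i := 0) (j := 1) (by decide) t ?_
  convert H using 1
  ext k l
  fin_cases k <;> fin_cases l <;>
    simp [Matrix.transvection, Matrix.mul_apply, Fin.sum_univ_three, *]

theorem row₁₀ (t : R) (H : IsTorusWord n !![a, b, c; d', e', f'; g, h, i])
    (h₁ : d' = d + t * a) (h₂ : e' = e + t * b) (h₃ : f' = f + t * c) :
    IsTorusWord (n + 1) !![a, b, c; d, e, f; g, h, i] := by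
  refine of_left (i := 1) (j := 0) (by decide) t ?_
  convert H using 1
  ext k l
  fin_cases k <;> fin_cases l <;>
    simp [Matrix.transvection, Matrix.mul_apply, Fin.sum_univ_three, add_comm, *]

theorem row₂₀ (t : R) (H : IsTorusWord n !![a, b, c; d, e, f; g', h', i'])
    (h₁ : g' = g + t * a) (h₂ : h' = h + t * b) (h₃ : i' = i + t * c) :
    IsTorusWord (n + 1) !![a, b, c; d, e, f; g, h, i] := by
  refine of_left (i := 2) (j := 0) (by decide) t ?_
  convert H using 1
  ext k l
  fin_cases k <;> fin_cases l <;>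
    simp [Matrix.transvection, Matrix.mul_apply, Fin.sum_univ_three, add_comm, *]

theorem row₂₁ (t : R) (H : IsTorusWord n !![a, b, c; d, e, f; g', h', i'])
    (h₁ : g' = g + t * d) (h₂ : h' = h + t * e) (h₃ : i' = i + t * f) :
    IsTorusWord (n + 1) !![a, b, c; d, e, f; g, h, i] := by
  refine of_left (i := 2) (j := 1) (by decide) t ?_
  convert H using 1
  ext k l
  fin_cases k <;> fin_cases l <;>
    simp [Matrix.transvection, Matrix.mul_apply, Fin.sum_univ_three, add_comm, *]

/-- Adding a multiple of one column to another, by transposition. -/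
theorem of_transpose (H : IsTorusWord n !![a, d, g; b, e, h; c, f, i]) :
    IsTorusWord n !![a, b, c; d, e, f; g, h, i] := by
  have := H.transpose
  convert this using 1
  ext k l
  fin_cases k <;> fin_cases l <;> rfl

theorem col₀₂ (t : R) (H : IsTorusWord n !![a', b, c; d', e, f; g', h, i])
    (h₁ : a' = a + t * c) (h₂ : d' = d + t * f) (h₃ : g' = g + t * i) :
    IsTorusWord (n + 1) !![a, b, c; d, e, f; g, h, i] :=
  of_transpose (row₀₂ t H.of_transpose h₁ h₂ h₃)

theorem col₁₂ (t : R) (H : IsTorusWord n !![a, b', c; d, e', f; g, h', i])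
    (h₁ : b' = b + t * c) (h₂ : e' = e + t * f) (h₃ : h' = h + t * i) :
    IsTorusWord (n + 1) !![a, b, c; d, e, f; g, h, i] :=
  of_transpose (row₁₂ t H.of_transpose h₁ h₂ h₃)

theorem col₀₁ (t : R) (H : IsTorusWord n !![a', b, c; d', e, f; g', h, i])
    (h₁ : a' = a + t * b) (h₂ : d' = d + t * e) (h₃ : g' = g + t * h) :
    IsTorusWord (n + 1) !![a, b, c; d, e, f; g, h, i] :=
  of_transpose (row₀₁ t H.of_transpose h₁ h₂ h₃)

theorem col₁₀ (t : R) (H : IsTorusWord n !![a, b', c; d, e', f; g, h', i])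
    (h₁ : b' = b + t * a) (h₂ : e' = e + t * d) (h₃ : h' = h + t * g) :
    IsTorusWord (n + 1) !![a, b, c; d, e, f; g, h, i] :=
  of_transpose (row₁₀ t H.of_transpose h₁ h₂ h₃)

theorem col₂₀ (t : R) (H : IsTorusWord n !![a, b, c'; d, e, f'; g, h, i'])
    (h₁ : c' = c + t * a) (h₂ : f' = f + t * d) (h₃ : i' = i + t * g) :
    IsTorusWord (n + 1) !![a, b, c; d, e, f; g, h, i] :=
  of_transpose (row₂₀ t H.of_transpose h₁ h₂ h₃)

theorem col₂₁ (t : R) (H : IsTorusWord n !![a, b, c'; d, e, f'; g, h, i'])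
    (h₁ : c' = c + t * b) (h₂ : f' = f + t * e) (h₃ : i' = i + t * h) :
    IsTorusWord (n + 1) !![a, b, c; d, e, f; g, h, i] :=
  of_transpose (row₂₁ t H.of_transpose h₁ h₂ h₃)

theorem diag (u v w : Rˣ) : IsTorusWord 0 !![(u : R), 0, 0; 0, v, 0; 0, 0, w] := by
  convert IsTorusWord.diagonal ![u, v, w] using 1
  ext k l
  fin_cases k <;> fin_cases l <;> simp

end Operations

/-- The factors `g₁` and `g₂` move from the upper right to the lower left corner. -/
theorem of_factors {x y b c g₁ g₂ z z' w : R} {u : Rˣ} (hdet : x * y - g₁ * g₂ * b * c = 1)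
    (hy : y = 1 + g₁ * z) (hx : x = -1 + g₂ * z') (hu : x = u + b * w) :
    IsTorusWord 13 !![x, g₁ * g₂ * b, 0; c, y, 0; 0, 0, 1] := by
  have huu : (u : R) * ↑u⁻¹ = 1 := u.mul_inv
  -- Four operations, relying on `y = 1 + g₁ z`, put `(x, g₂ b; g₁ c, y)` into rows and columns `0`
  -- and `2`. The middle diagonal entry becomes `1`.
  refine row₀₂ (g₂ * b) (a' := x) (b' := g₁ * g₂ * b) (c' := g₂ * b) ?_ (by ring) (by ring) (by ring)
  refine row₁₂ z (d' := c) (e' := y) (f' := z) ?_ (by ring) (by ring) (by ring)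
  refine col₁₂ (-g₁) (b' := 0) (e' := 1) (h' := -g₁) ?_ (by ring)
    (by linear_combination -hy) (by ring)
  refine row₂₁ g₁ (g' := g₁ * c) (h' := 0) (i' := y) ?_ (by ring) (by ring)
    (by linear_combination hy)
  -- In the same spirit `x = -1 + g₂ z'` moves `g₂`: four operations leave `-1` in the corner and
  -- the block `(-x, b; -g₁ g₂ c, y)`.
  refine col₀₁ (z' - c) (a' := x) (d' := z') (g' := g₁ * c) ?_ (by ring) (by ring) (by ring)
  refine col₂₁ (b - z) (c' := g₂ * b) (f' := b) (i' := y) ?_ (by ring) (by ring) (by ring)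
  refine row₀₁ (-g₂) (a' := -1) (b' := -g₂) (c' := 0) ?_
    (by linear_combination -hx) (by ring) (by ring)
  refine col₁₀ (-g₂) (b' := 0) (e' := -x) (h' := -g₂ * (g₁ * c)) ?_ (by ring)
    (by linear_combination -hx) (by ring)
  -- With `b` alone beside it, `-x` can be changed into the unit `-u`. Four more operations clear
  -- the rest, which makes thirteen.
  refine col₁₂ w (b' := 0) (e' := -u) (h' := -g₂ * (g₁ * c) + w * y) ?_ (by ring)
    (by linear_combination hu) (by ring)
  refine row₁₀ z' (d' := 0) (e' := -u) (f' := b) ?_ (by ring) (by ring) (by ring)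
  refine row₂₀ (g₁ * c) (g' := 0) (h' := -g₂ * (g₁ * c) + w * y) (i' := y) ?_
    (by ring) (by ring) (by ring)
  refine col₂₁ (↑u⁻¹ * b) (c' := 0) (f' := 0) (i' := ↑u⁻¹) ?_ (by ring)
    (by linear_combination b * huu)
    (by linear_combination y * huu + ↑u⁻¹ * y * hu - ↑u⁻¹ * hdet)
  refine row₂₁ (↑u⁻¹ * (-g₂ * (g₁ * c) + w * y)) (g' := 0) (h' := 0) (i' := ↑u⁻¹) ?_
    (by ring) (by linear_combination (-g₂ * (g₁ * c) + w * y) * huu) (by ring)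
  have := diag (-1) (-u) u⁻¹
  simpa using this

end IsTorusWord

end TransvectionWords

/-! ### `SL 2` over `F[X]` inside `SL 3` -/

section SpecialLinear

open Matrix Polynomial

/-- Powers of a matrix of determinant one in the upper left corner are linear combinations of it
and of the identity. -/
theorem exists_pow_eq {R : Type*} [CommRing R] {a b c d : R} (hdet : a * d - b * c = 1) (k : ℕ) :
    ∃ f g : R, !![a, b, 0; c, d, 0; 0, 0, 1] ^ k =
      !![f + g * a, g * b, 0; g * c, f + g * d, 0; 0, 0, 1] ∧
      f ^ 2 + f * g * (a + d) + g ^ 2 = 1 ∧ b ∣ f + g * a - a ^ k := by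
  induction k with
  | zero =>
    refine ⟨1, 0, ?_, by ring, by simp⟩
    ext i j
    fin_cases i <;> fin_cases j <;> simp
  | succ k ih =>
    obtain ⟨f, g, h1, h2, s, hs⟩ := ih
    -- By Cayley–Hamilton, `(f + g A) A = -g + (f + g (a + d)) A`. The quadratic relation says that
    -- the power has determinant one.
    refine ⟨-g, f + g * (a + d), ?_, by linear_combination h2, s * a + g * c, ?_⟩
    · rw [pow_succ, h1]
      ext i j
      fin_cases i <;> fin_cases j <;> simp [Matrix.mul_apply, Fin.sum_univ_three]
      · linear_combination -g * hdet
      · ring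
      · ring
      · linear_combination -g * hdet
    · linear_combination a * hs + g * hdet

/-- A divisor of `(f - 1) (f + 1)` splits accordingly. -/
theorem exists_eq_mul_dvd_sub_one {R : Type*} [CommRing R] [IsDomain R] [IsPrincipalIdealRing R]
    {f g : R} (h : g ∣ f ^ 2 - 1) :
    ∃ g₁ g₂ z₁ z₂, g = g₁ * g₂ ∧ f = 1 + g₁ * z₁ ∧ f = -1 + g₂ * z₂ := by
  obtain ⟨u, v, huv⟩ : ∃ u v, g = u * v ∧ u ∣ f - 1 ∧ v ∣ f + 1 := by
    have h' : g ∣ (f - 1) * (f + 1) := by convert h using 1; ring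
    obtain ⟨u, v, hu, hv, rfl⟩ := exists_dvd_and_dvd_of_dvd_mul h'
    exact ⟨u, v, rfl, hu, hv⟩
  obtain ⟨rfl, ⟨z₁, h₁⟩, z₂, h₂⟩ := huv
  exact ⟨u, v, z₁, z₂, rfl, by linear_combination h₁, by linear_combination h₂⟩

/-- Write the power as `f + g A`. Its determinant shows that `g` divides `f ^ 2 - 1`, so `g` splits
into a divisor of `f - 1` and one of `f + 1`. Its upper left entry is congruent to `a ^ k`, hence to
a unit, modulo `b`. These are the inputs of `IsTorusWord.of_factors`. -/
theorem isTorusWord_pow {R : Type*} [CommRing R] [IsDomain R] [IsPrincipalIdealRing R]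
    {a b c d : R} (hdet : a * d - b * c = 1) {k : ℕ} {u : Rˣ} (hk : b ∣ a ^ k - u) :
    IsTorusWord 13 (!![a, b, 0; c, d, 0; 0, 0, 1] ^ k) := by
  obtain ⟨f, g, hpow, hfg, hb⟩ := exists_pow_eq hdet k
  obtain ⟨g₁, g₂, z₁, z₂, rfl, h₁, h₂⟩ := exists_eq_mul_dvd_sub_one (f := f) (g := g)
    ⟨-(f * (a + d) + g), by linear_combination hfg⟩
  obtain ⟨w, hw⟩ := (dvd_add hb hk)
  rw [hpow]
  refine IsTorusWord.of_factors (z := z₁ + g₂ * d) (z' := z₂ + g₁ * a) (w := w) (u := u) ?_ ?_ ?_ ?_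
  · linear_combination hfg + (g₁ * g₂) ^ 2 * hdet
  · linear_combination h₁
  · linear_combination h₂
  · linear_combination hw

/-- The greatest common divisor of `q ^ m - 1` and `q ^ (m + 1) - 1` is `q - 1`, so the two
quotients are coprime. -/
theorem exists_modEq_mul (q m : ℕ) (hq : 1 < q) (hm : 0 < m) : ∃ u v : ℕ,
    (q ^ m - 1) / (q - 1) * u = (q ^ (m + 1) - 1) / (q - 1) * v + 1 := by
  have hgcd : Nat.gcd (q ^ m - 1) (q ^ (m + 1) - 1) = q - 1 := by
    rw [Nat.pow_sub_one_gcd_pow_sub_one, Nat.gcd_self_add_right]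
    simp
  have hpos : 0 < Nat.gcd (q ^ m - 1) (q ^ (m + 1) - 1) := by omega
  have hco := Nat.coprime_div_gcd_div_gcd hpos
  rw [hgcd] at hco
  have h1 : 1 < (q ^ (m + 1) - 1) / (q - 1) := by
    have : q ^ (m + 1) ≥ q ^ 2 := Nat.pow_le_pow_right (by omega) (by omega)
    have h2 : q ^ 2 - 1 = (q + 1) * (q - 1) := by
      obtain ⟨r, rfl⟩ : ∃ r, q = r + 1 := ⟨q - 1, by omega⟩
      simp
      have : (r + 1) ^ 2 = (r + 1 + 1) * r + 1 := by ring
      omega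
    have h3 : q + 1 ≤ (q ^ (m + 1) - 1) / (q - 1) := by
      rw [Nat.le_div_iff_mul_le (by omega), ← h2]
      omega
    omega
  obtain ⟨u, -, hu⟩ := Nat.exists_mul_mod_eq_one_of_coprime hco h1
  refine ⟨u, (q ^ m - 1) / (q - 1) * u / ((q ^ (m + 1) - 1) / (q - 1)), ?_⟩
  conv_lhs => rw [← Nat.div_add_mod ((q ^ m - 1) / (q - 1) * u) ((q ^ (m + 1) - 1) / (q - 1)), hu]

variable {F : Type*} [Field F] [Finite F]

/-- Modulo an irreducible polynomial, the norm of a residue class is a constant. -/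
theorem exists_dvd_pow_sub_C {P a : F[X]} (hP : P.Monic) (hPi : Irreducible P)
    (h : IsCoprime P a) : ∃ u : F[X]ˣ,
      P ∣ a ^ ((Nat.card F ^ P.natDegree - 1) / (Nat.card F - 1)) - u := by
  have := Fact.mk hPi
  have := hP.finite_adjoinRoot
  have hfin : Finite (AdjoinRoot P) := Module.finite_of_finite F
  have hne : AdjoinRoot.mk P a ≠ 0 := (isUnit_mk_of_isCoprime h).ne_zero
  have hnorm := FiniteField.algebraMap_norm_eq_pow (K := F) (x := AdjoinRoot.mk P a)
  have hn0 : Algebra.norm F (AdjoinRoot.mk P a) ≠ 0 := Algebra.norm_ne_zero_iff.mpr hne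
  refine ⟨Units.map (C : F →+* F[X]) (Units.mk0 _ hn0), ?_⟩
  rw [← AdjoinRoot.mk_eq_mk, map_pow, ← natCard_adjoinRoot hP, ← hnorm]
  rfl

/-- Norms make suitable powers of `a` constant modulo `b` and modulo `c`. Consecutive degrees make
the two exponents coprime, so two powers of the matrix differ by one factor of the matrix itself.
The power belonging to `c` is treated by transposition. -/
theorem isTorusWord_of_irreducible {a b c d : F[X]} (hdet : a * d - b * c = 1) (hb : b.Monic)
    (hbi : Irreducible b) (hc : c.Monic) (hci : Irreducible c)
    (hdeg : c.natDegree = b.natDegree + 1) :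
    IsTorusWord 26 !![a, b, 0; c, d, 0; 0, 0, 1] := by
  obtain ⟨u, v, huv⟩ := exists_modEq_mul (Nat.card F) b.natDegree Finite.one_lt_card
    hbi.natDegree_pos
  obtain ⟨u₁, h₁⟩ := exists_dvd_pow_sub_C (a := a) hb hbi ⟨-c, d, by linear_combination hdet⟩
  obtain ⟨u₂, h₂⟩ := exists_dvd_pow_sub_C (a := a) hc hci ⟨-b, d, by linear_combination hdet⟩
  rw [hdeg] at h₂
  have w₁ : IsTorusWord 13 (!![a, b, 0; c, d, 0; 0, 0, 1] ^
      ((Nat.card F ^ b.natDegree - 1) / (Nat.card F - 1) * u)) := by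
    refine isTorusWord_pow hdet (u := u₁ ^ u) ?_
    rw [pow_mul, Units.val_pow_eq_pow_val]
    exact h₁.trans (sub_dvd_pow_sub_pow _ _ _)
  have w₂ : IsTorusWord 13 (!![a, b, 0; c, d, 0; 0, 0, 1] ^
      ((Nat.card F ^ (b.natDegree + 1) - 1) / (Nat.card F - 1) * v)) := by
    have := isTorusWord_pow (a := a) (b := c) (c := b) (d := d)
      (by linear_combination hdet) (u := u₂ ^ v)
      (k := (Nat.card F ^ (b.natDegree + 1) - 1) / (Nat.card F - 1) * v) (by
        rw [pow_mul, Units.val_pow_eq_pow_val]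
        exact h₂.trans (sub_dvd_pow_sub_pow _ _ _))
    have ht := this.transpose
    rw [Matrix.transpose_pow] at ht
    convert ht using 2
    ext i j
    fin_cases i <;> fin_cases j <;> rfl
  rw [huv, pow_succ] at w₁
  exact w₂.of_mul w₁

theorem isTorusWord_of_isUnit {R : Type*} [CommRing R] {a b c d : R}
    (hdet : a * d - b * c = 1) (ha : IsUnit a) :
    IsTorusWord 2 !![a, b, 0; c, d, 0; 0, 0, 1] := by
  obtain ⟨u, rfl⟩ := ha
  have hu : (u : R) * ↑u⁻¹ = 1 := u.mul_inv
  refine IsTorusWord.row₁₀ (-(↑u⁻¹ * c)) (d' := 0) (e' := ↑u⁻¹) (f' := 0) ?_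
    (by linear_combination c * hu) (by linear_combination d * hu - ↑u⁻¹ * hdet) (by ring)
  refine IsTorusWord.col₁₀ (-(↑u⁻¹ * b)) (b' := 0) (e' := ↑u⁻¹) (h' := 0) ?_
    (by linear_combination b * hu) (by ring) (by ring)
  simpa using IsTorusWord.diag u u⁻¹ 1

/-- One column and one row operation replace `b` and `c` by irreducibles in their classes modulo
`a`, which adds 2 to 26. Dirichlet's theorem needs a nonconstant modulus, so `a` zero or a unit is
treated apart. -/
theorem isTorusWord_two {a b c d : F[X]} (hdet : a * d - b * c = 1) :
    IsTorusWord 28 !![a, b, 0; c, d, 0; 0, 0, 1] := by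
  have mono : ∀ {n m : ℕ} {A : Matrix (Fin 3) (Fin 3) F[X]}, n ≤ m → IsTorusWord n A →
      IsTorusWord m A := fun h ⟨l, D, hl, e⟩ => ⟨l, D, hl.trans h, e⟩
  by_cases hu : IsUnit a
  · exact mono (by norm_num) (isTorusWord_of_isUnit hdet hu)
  by_cases h0 : a = 0
  -- For `a = 0` the entry `b` is a unit, and adding the second column to the first brings it into
  -- the corner.
  · refine mono (n := 3) (by norm_num) ?_
    refine IsTorusWord.col₀₁ 1 (a' := b) (d' := c + d) (g' := 0) ?_ (by rw [h0]; ring) (by ring)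
      (by ring)
    refine isTorusWord_of_isUnit (by linear_combination hdet - d * h0)
      (IsUnit.of_mul_eq_one (-c) (by linear_combination hdet - d * h0))
  set n : F[X] := a * C a.leadingCoeff⁻¹ with hn
  have hm : n.Monic := monic_mul_leadingCoeff_inv h0
  have han : a ∣ n := dvd_mul_right _ _
  have hna : n ∣ a := ⟨C a.leadingCoeff, by
    rw [hn, mul_assoc, ← C_mul, inv_mul_cancel₀ (leadingCoeff_ne_zero.mpr h0), C_1, mul_one]⟩
  have hd : 0 < n.natDegree := by
    by_contra h
    exact hu (isUnit_of_dvd_one (han.trans (hm.natDegree_eq_zero.mp (by omega) ▸ dvd_rfl)))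
  have hco : ∀ x y : F[X], a * x - y = 1 → ∀ t, t ∣ y → IsCoprime n t := by
    rintro x _ hxy t ⟨s, rfl⟩
    refine IsCoprime.of_isCoprime_of_dvd_left (y := a) ⟨x, -s, by linear_combination hxy⟩
      hna
  obtain ⟨N₁, hN₁⟩ := exists_monic_irreducible_natDegree_eq hm hd
    (hco d (b * c) hdet b (dvd_mul_right _ _))
  obtain ⟨N₂, hN₂⟩ := exists_monic_irreducible_natDegree_eq hm hd
    (hco d (b * c) hdet c (dvd_mul_left _ _))
  obtain ⟨P, hPm, hPi, hPd, hPb⟩ := hN₁ (max N₁ N₂) (le_max_left _ _)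
  obtain ⟨Q, hQm, hQi, hQd, hQc⟩ := hN₂ (max N₁ N₂ + 1) (by omega)
  obtain ⟨s, hs⟩ := han.trans hPb
  obtain ⟨t, ht⟩ := han.trans hQc
  refine IsTorusWord.col₁₀ s (b' := P) (e' := d + s * c) (h' := 0) ?_
    (by linear_combination hs) (by ring) (by ring)
  refine IsTorusWord.row₁₀ t (d' := Q) (e' := d + s * c + t * P) (f' := 0) ?_
    (by linear_combination ht) (by ring) (by ring)
  exact isTorusWord_of_irreducible (by linear_combination hdet - P * ht - c * hs) hPm hPi hQm hQi
    (by rw [hQd, hPd])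

end SpecialLinear

/-! ### From `SL 3` to `SL 2` by stable range -/

section Reduction

open Matrix

variable {R : Type*} [CommRing R] [IsDomain R] [IsPrincipalIdealRing R]

/-- The product of the prime factors of `x` that satisfy `S` serves. It stands in for the Chinese
remainder theorem. -/
theorem exists_prime_dvd_iff {x : R} (hx : x ≠ 0) (S : R → Prop)
    (hS : ∀ p p', Associated p p' → S p → S p') :
    ∃ ξ : R, ∀ p, Prime p → p ∣ x → (p ∣ ξ ↔ S p) := by
  classical
  refine ⟨((UniqueFactorizationMonoid.factors x).filter S).prod, fun p hp hpx => ⟨fun h => ?_,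
    fun h => ?_⟩⟩
  · obtain ⟨r, hr, hpr⟩ := hp.exists_mem_multiset_dvd h
    obtain ⟨hr, hrS⟩ := Multiset.mem_filter.mp hr
    exact hS r p (hp.associated_of_dvd (UniqueFactorizationMonoid.prime_of_factor r hr) hpr).symm hrS
  · obtain ⟨r, hr, hpr⟩ := UniqueFactorizationMonoid.exists_mem_factors_of_dvd hx hp.irreducible hpx
    exact hpr.dvd.trans (Multiset.dvd_prod (Multiset.mem_filter.mpr ⟨hr, hS p r hpr h⟩))

/-- If for no prime divisor of `x` both vectors `v` and `w` vanish, then some `v + ξ w` vanishes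
modulo no prime divisor of `x`. -/
theorem exists_add_mul_not_dvd {ι : Type*} {x : R} (hx : x ≠ 0) (v w : ι → R)
    (h : ∀ p, Prime p → p ∣ x → (∀ i, p ∣ v i) → (∀ i, p ∣ w i) → False) :
    ∃ ξ : R, ∀ p, Prime p → p ∣ x → ∃ i, ¬ p ∣ v i + ξ * w i := by
  -- Modulo each prime, either `ξ` vanishes and `v` does not, or `v` vanishes and `ξ` is invertible.
  obtain ⟨ξ, hξ⟩ := exists_prime_dvd_iff hx (fun p => ∃ i, ¬ p ∣ v i)
    fun p p' hpp ⟨i, hi⟩ => ⟨i, fun h => hi (hpp.dvd.trans h)⟩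
  refine ⟨ξ, fun p hp hpx => ?_⟩
  by_cases hv : ∃ i, ¬ p ∣ v i
  · obtain ⟨i, hi⟩ := hv
    refine ⟨i, fun hd => hi ?_⟩
    exact (dvd_add_left (((hξ p hp hpx).mpr ⟨i, hi⟩).mul_right _)).mp hd
  · have hξp : ¬ p ∣ ξ := fun hd => hv ((hξ p hp hpx).mp hd)
    push Not at hv
    by_contra! hall
    refine h p hp hpx hv fun i => ?_
    exact (hp.dvd_or_dvd ((dvd_add_right (hv i)).mp (hall i))).resolve_left hξp

theorem exists_isCoprime_add_mul {x y z : R} (hx : x ≠ 0)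
    (h : ∀ p, Prime p → p ∣ x → p ∣ y → p ∣ z → False) : ∃ ξ, IsCoprime x (y + ξ * z) := by
  obtain ⟨ξ, hξ⟩ := exists_add_mul_not_dvd (ι := Unit) hx (fun _ => y) (fun _ => z)
    fun p hp hpx hy hz => h p hp hpx (hy ()) (hz ())
  refine ⟨ξ, isCoprime_of_prime_dvd (fun h0 => hx h0.1) fun p hp hpx hd => ?_⟩
  obtain ⟨_, hi⟩ := hξ p hp hpx
  exact hi hd

/-- A Bézout relation makes the lower right entry `1` in two column operations. Four more clear the
rest of the last row and column. -/
theorem isTorusWord_of_isCoprime {R : Type*} [CommRing R] {n : ℕ}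
    (hn : ∀ a b c d : R, a * d - b * c = 1 → IsTorusWord n !![a, b, 0; c, d, 0; 0, 0, 1])
    {a b c d e f x y z : R} (hdet : (!![a, b, c; d, e, f; x, y, z]).det = 1)
    (hxy : IsCoprime x y) : IsTorusWord (n + 6) !![a, b, c; d, e, f; x, y, z] := by
  obtain ⟨u, v, huv⟩ := hxy
  have hdet' := hdet
  rw [det_fin_three] at hdet'
  simp at hdet'
  obtain ⟨r, hr⟩ : ∃ r, r = u * (1 - z) := ⟨_, rfl⟩
  obtain ⟨s, hs⟩ : ∃ s, s = v * (1 - z) := ⟨_, rfl⟩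
  have hz : z + r * x + s * y = 1 := by rw [hr, hs]; linear_combination (1 - z) * huv
  refine IsTorusWord.col₂₀ r (c' := c + r * a) (f' := f + r * d) (i' := z + r * x) ?_
    rfl rfl rfl
  refine IsTorusWord.col₂₁ s (c' := c + r * a + s * b) (f' := f + r * d + s * e) (i' := 1) ?_
    rfl rfl hz.symm
  obtain ⟨c', hc'⟩ : ∃ c', c' = c + r * a + s * b := ⟨_, rfl⟩
  obtain ⟨f', hf'⟩ : ∃ f', f' = f + r * d + s * e := ⟨_, rfl⟩
  rw [← hc', ← hf']
  refine IsTorusWord.col₀₂ (-x) (a' := a - x * c') (d' := d - x * f') (g' := 0) ?_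
    (by ring) (by ring) (by ring)
  refine IsTorusWord.col₁₂ (-y) (b' := b - y * c') (e' := e - y * f') (h' := 0) ?_
    (by ring) (by ring) (by ring)
  refine IsTorusWord.row₀₂ (-c') (a' := a - x * c') (b' := b - y * c') (c' := 0) ?_
    (by ring) (by ring) (by ring)
  refine IsTorusWord.row₁₂ (-f') (d' := d - x * f') (e' := e - y * f') (f' := 0) ?_
    (by ring) (by ring) (by ring)
  refine hn _ _ _ _ ?_
  rw [hc', hf']
  linear_combination hdet' - (a * e - b * d) * hz

theorem isTorusWord_three {n : ℕ}
    (hn : ∀ a b c d : R, a * d - b * c = 1 → IsTorusWord n !![a, b, 0; c, d, 0; 0, 0, 1])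
    (A : Matrix (Fin 3) (Fin 3) R) (hdet : A.det = 1) : IsTorusWord (n + 7) A := by
  rw [A.eta_fin_three] at hdet ⊢
  generalize A 0 0 = a, A 0 1 = b, A 0 2 = c, A 1 0 = d, A 1 1 = e, A 1 2 = f, A 2 0 = x,
    A 2 1 = y, A 2 2 = z at hdet ⊢
  have hdet' := hdet
  rw [det_fin_three] at hdet'
  simp at hdet'
  have hp : ∀ p, Prime p → p ∣ x → p ∣ y → p ∣ z → False := by
    rintro p hp ⟨x, rfl⟩ ⟨y, rfl⟩ ⟨z, rfl⟩
    refine hp.not_dvd_one ⟨a * e * z - a * f * y - b * d * z + b * f * x + c * d * y - c * e * x, ?_⟩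
    linear_combination -hdet'
  have h : (∃ t, IsCoprime x (y + t * z)) ∨ ∃ t, IsCoprime (x + t * z) y := by
    by_cases hx : x = 0
    · right
      by_cases hy : y = 0
      · refine ⟨a * e - b * d, ?_⟩
        rw [show x + (a * e - b * d) * z = 1 by
          linear_combination hdet' + (a * f - c * d) * hy + (1 - b * f + c * e) * hx]
        exact isCoprime_one_left
      · obtain ⟨t, ht⟩ := exists_isCoprime_add_mul (y := x) (z := z) hy
          fun p h1 h2 h3 h4 => hp p h1 h3 h2 h4
        exact ⟨t, ht.symm⟩
    · exact Or.inl (exists_isCoprime_add_mul hx hp)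
  rcases h with ⟨t, ht⟩ | ⟨t, ht⟩
  · refine IsTorusWord.col₁₂ t (b' := b + t * c) (e' := e + t * f) (h' := y + t * z) ?_ rfl rfl rfl
    refine isTorusWord_of_isCoprime hn ?_ ht
    rw [det_fin_three]
    simp
    linear_combination hdet'
  · refine IsTorusWord.col₀₂ t (a' := a + t * c) (d' := d + t * f) (g' := x + t * z) ?_ rfl rfl rfl
    refine isTorusWord_of_isCoprime hn ?_ ht
    rw [det_fin_three]
    simp
    linear_combination hdet'

/-- The torus of `SL 3` is the product of two coroot tori, and each `diag(u, u⁻¹)` takes four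
transvections. -/
theorem diagonal_eq_prod_transvection {R : Type*} [CommRing R] {u u' v w w' : R}
    (hu : u * u' = 1) (hw : w * w' = 1) (hv : v = u' * w') : diagonal ![u, v, w] =
      ([⟨1, 0, by decide, -u'⟩, ⟨0, 1, by decide, u - 1⟩, ⟨1, 0, by decide, 1⟩,
        ⟨0, 1, by decide, u' - 1⟩, ⟨1, 2, by decide, -w'⟩, ⟨2, 1, by decide, w - 1⟩,
        ⟨1, 2, by decide, 1⟩, ⟨2, 1, by decide, w' - 1⟩].map
          (TransvectionStruct.toMatrix : TransvectionStruct (Fin 3) R → _)).prod := by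
  have e₁ : ∀ r : R, transvection (1 : Fin 3) 0 r = !![1, 0, 0; r, 1, 0; 0, 0, 1] := by
    intro r; ext i j; fin_cases i <;> fin_cases j <;> simp [transvection]
  have e₂ : ∀ r : R, transvection (0 : Fin 3) 1 r = !![1, r, 0; 0, 1, 0; 0, 0, 1] := by
    intro r; ext i j; fin_cases i <;> fin_cases j <;> simp [transvection]
  have e₃ : ∀ r : R, transvection (1 : Fin 3) 2 r = !![1, 0, 0; 0, 1, r; 0, 0, 1] := by
    intro r; ext i j; fin_cases i <;> fin_cases j <;> simp [transvection]
  have e₄ : ∀ r : R, transvection (2 : Fin 3) 1 r = !![1, 0, 0; 0, 1, 0; 0, r, 1] := by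
    intro r; ext i j; fin_cases i <;> fin_cases j <;> simp [transvection]
  have h₁ : transvection (1 : Fin 3) 0 (-u') * (transvection 0 1 (u - 1) *
      (transvection 1 0 1 * transvection 0 1 (u' - 1))) = !![u, 0, 0; 0, u', 0; 0, 0, 1] := by
    rw [e₁, e₂, e₁, e₂]
    ext i j
    fin_cases i <;> fin_cases j <;> simp [Matrix.mul_apply, Fin.sum_univ_three]
    · linear_combination hu
    · linear_combination -hu
    · linear_combination u' * hu
  have h₂ : transvection (1 : Fin 3) 2 (-w') * (transvection 2 1 (w - 1) *
      (transvection 1 2 1 * transvection 2 1 (w' - 1))) = !![1, 0, 0; 0, w', 0; 0, 0, w] := by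
    rw [e₃, e₄, e₃, e₄]
    ext i j
    fin_cases i <;> fin_cases j <;> simp [Matrix.mul_apply, Fin.sum_univ_three]
    · linear_combination w' * hw
    · linear_combination -hw
    · linear_combination hw
  simp only [List.map_cons, List.map_nil, List.prod_cons, List.prod_nil, mul_one,
    TransvectionStruct.toMatrix_mk]
  have h₃ : diagonal ![u, v, w] =
      !![u, 0, 0; 0, u', 0; 0, 0, 1] * !![1, 0, 0; 0, w', 0; 0, 0, w] := by
    ext i j
    fin_cases i <;> fin_cases j <;> simp [Matrix.mul_apply, Fin.sum_univ_three, hv]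
  rw [h₃, ← h₁, ← h₂]
  simp only [mul_assoc]

open Polynomial in
/-- A quantitative form of bounded generation for `SL 3` over polynomials in one variable over a
finite field. -/
theorem exists_list_transvection {F : Type*} [Field F] [Finite F]
    (A : Matrix (Fin 3) (Fin 3) F[X]) (hdet : A.det = 1) :
    ∃ l : List (TransvectionStruct (Fin 3) F[X]), l.length ≤ 43 ∧
      A = (l.map TransvectionStruct.toMatrix).prod := by
  obtain ⟨l, D, hl, rfl⟩ := isTorusWord_three (fun _ _ _ _ => isTorusWord_two) A hdet
  rw [det_mul, TransvectionStruct.det_toMatrix_prod, one_mul, det_diagonal,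
    Fin.prod_univ_three] at hdet
  have hu : (D 0 : F[X]) * ↑(D 0)⁻¹ = 1 := (D 0).mul_inv
  have hw : (D 2 : F[X]) * ↑(D 2)⁻¹ = 1 := (D 2).mul_inv
  have hv : (D 1 : F[X]) = ↑(D 0)⁻¹ * ↑(D 2)⁻¹ := by
    linear_combination ↑(D 0)⁻¹ * ↑(D 2)⁻¹ * hdet - (D 1 : F[X]) * D 2 * ↑(D 2)⁻¹ * hu -
      (D 1 : F[X]) * hw
  have hD : (fun i => (D i : F[X])) = ![(D 0 : F[X]), D 1, D 2] := by
    ext1 i; fin_cases i <;> rfl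
  have key := diagonal_eq_prod_transvection hu hw hv
  -- The count is 28 + 7 for the torus word and 8 for its diagonal part.
  rw [hD, key, ← List.prod_append, ← List.map_append]
  exact ⟨_, by rw [List.length_append]; exact Nat.add_le_add hl le_rfl, rfl⟩

end Reduction

/-! ### Spinors as split octonions -/

section Spinors

open Matrix

variable {R : Type*} [CommRing R]

/-- The polar form of the split quadratic form in seven variables. -/
def splitPolar7 (v w : Fin 7 → R) : R :=
  v 0 * w 6 + v 6 * w 0 + v 1 * w 5 + v 5 * w 1 + v 2 * w 4 + v 4 * w 2 + 2 * (v 3 * w 3)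

theorem splitForm7_add (v w : Fin 7 → R) :
    splitForm7 (v + w) = splitForm7 v + splitForm7 w + splitPolar7 v w := by
  simp only [splitForm7, splitPolar7, Pi.add_apply]; ring

/-- The norm form on spinors, that is, on split octonions in Zorn's coordinates. -/
def spinNorm (s : Fin 8 → R) : R := s 0 * s 7 - s 1 * s 4 - s 2 * s 5 - s 3 * s 6

/-- The polar form of the norm form on spinors. -/
def spinPolar (s t : Fin 8 → R) : R :=
  s 0 * t 7 + t 0 * s 7 - (s 1 * t 4 + t 1 * s 4) - (s 2 * t 5 + t 2 * s 5) -
    (s 3 * t 6 + t 3 * s 6)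

theorem spinNorm_add (s t : Fin 8 → R) :
    spinNorm (s + t) = spinNorm s + spinNorm t + spinPolar s t := by
  simp only [spinNorm, spinPolar, Pi.add_apply]; ring

/-- Clifford multiplication of vectors on spinors: left multiplication by split octonions of trace
zero in Zorn's coordinates. -/
def clifford : (Fin 7 → R) →ₗ[R] (Fin 8 → R) →ₗ[R] (Fin 8 → R) :=
  LinearMap.mk₂ R (fun v s =>
    ![v 3 * s 0 + (v 0 * s 4 + v 1 * s 5 + v 2 * s 6),
      v 3 * s 1 + v 0 * s 7 - (v 5 * s 6 - v 4 * s 5),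
      v 3 * s 2 + v 1 * s 7 - (v 4 * s 4 - v 6 * s 6),
      v 3 * s 3 + v 2 * s 7 - (v 6 * s 5 - v 5 * s 4),
      v 6 * s 0 - v 3 * s 4 + (v 1 * s 3 - v 2 * s 2),
      v 5 * s 0 - v 3 * s 5 + (v 2 * s 1 - v 0 * s 3),
      v 4 * s 0 - v 3 * s 6 + (v 0 * s 2 - v 1 * s 1),
      -(v 3 * s 7) + (v 6 * s 1 + v 5 * s 2 + v 4 * s 3)])
    (fun v w s => by ext i; fin_cases i <;> simp <;> ring)
    (fun c v s => by ext i; fin_cases i <;> simp <;> ring)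
    (fun v s t => by ext i; fin_cases i <;> simp <;> ring)
    (fun c v s => by ext i; fin_cases i <;> simp <;> ring)

theorem clifford_apply (v : Fin 7 → R) (s : Fin 8 → R) : clifford v s =
    ![v 3 * s 0 + (v 0 * s 4 + v 1 * s 5 + v 2 * s 6),
      v 3 * s 1 + v 0 * s 7 - (v 5 * s 6 - v 4 * s 5),
      v 3 * s 2 + v 1 * s 7 - (v 4 * s 4 - v 6 * s 6),
      v 3 * s 3 + v 2 * s 7 - (v 6 * s 5 - v 5 * s 4),
      v 6 * s 0 - v 3 * s 4 + (v 1 * s 3 - v 2 * s 2),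
      v 5 * s 0 - v 3 * s 5 + (v 2 * s 1 - v 0 * s 3),
      v 4 * s 0 - v 3 * s 6 + (v 0 * s 2 - v 1 * s 1),
      -(v 3 * s 7) + (v 6 * s 1 + v 5 * s 2 + v 4 * s 3)] := rfl

/-- The Clifford relation: octonions are alternative, and the square of a trace zero octonion is
minus its norm, which here is the quadratic form. -/
theorem clifford_clifford_self (v : Fin 7 → R) (s : Fin 8 → R) :
    clifford v (clifford v s) = splitForm7 v • s := by
  ext i
  fin_cases i <;> simp [clifford_apply, splitForm7] <;> ring

theorem clifford_swap (v w : Fin 7 → R) (s : Fin 8 → R) :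
    clifford v (clifford w s) = splitPolar7 v w • s - clifford w (clifford v s) := by
  have h := clifford_clifford_self (v + w) s
  rw [splitForm7_add] at h
  simp only [map_add, LinearMap.add_apply, clifford_clifford_self, add_smul] at h
  linear_combination (exp := 1) h

theorem spinNorm_clifford (v : Fin 7 → R) (s : Fin 8 → R) :
    spinNorm (clifford v s) = -(splitForm7 v * spinNorm s) := by
  simp [clifford_apply, spinNorm, splitForm7]; ring

theorem spinPolar_clifford (v : Fin 7 → R) (s t : Fin 8 → R) :
    spinPolar s (clifford v t) = -spinPolar (clifford v s) t := by
  simp [clifford_apply, spinPolar]; ring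

theorem spinPolar_clifford_clifford (v w : Fin 7 → R) (s : Fin 8 → R) :
    spinPolar (clifford v s) (clifford w s) = -(splitPolar7 v w * spinNorm s) := by
  simp [clifford_apply, spinPolar, splitPolar7, spinNorm]; ring

/-- The lift of the Eichler transformation of an isotropic vector `u` and a vector `w` orthogonal
to it. -/
def spinTransvection (u w : Fin 7 → R) (hu : splitForm7 u = 0)
    (huw : splitPolar7 u w = 0) : (Fin 8 → R) ≃ₗ[R] (Fin 8 → R) :=
  -- The operators of `u` and `w` anticommute and that of `u` has square zero. So their product has
  -- square zero, and `1 - u w` inverts `1 + u w`.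
  have key : ∀ s, clifford u (clifford w (clifford u (clifford w s))) = 0 := fun s => by
    rw [clifford_swap u w, huw, clifford_clifford_self u, hu]; simp
  { LinearMap.id + (clifford u).comp (clifford w) with
    invFun := fun s => s - clifford u (clifford w s)
    left_inv := fun s => by simp [key]
    right_inv := fun s => by simp [key] }

theorem spinTransvection_apply (u w : Fin 7 → R) (hu : splitForm7 u = 0)
    (huw : splitPolar7 u w = 0) (s : Fin 8 → R) :
    spinTransvection u w hu huw s = s + clifford u (clifford w s) := rfl

/-- A linear automorphism of the spinors lies over the transformation `g` of the vectors. -/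
structure IsSpinLift (g : Matrix (Fin 7) (Fin 7) R) (h : (Fin 8 → R) ≃ₗ[R] (Fin 8 → R)) :
    Prop where
  act : ∀ v s, h (clifford v s) = clifford (g *ᵥ v) (h s)
  norm : ∀ s, spinNorm (h s) = spinNorm s

namespace IsSpinLift

variable {g g' : Matrix (Fin 7) (Fin 7) R} {h h' : (Fin 8 → R) ≃ₗ[R] (Fin 8 → R)}

theorem one : IsSpinLift (1 : Matrix (Fin 7) (Fin 7) R) 1 :=
  ⟨fun v s => by simp, fun s => rfl⟩

theorem mul (H : IsSpinLift g h) (H' : IsSpinLift g' h') : IsSpinLift (g * g') (h * h') :=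
  ⟨fun v s => by
    rw [LinearEquiv.mul_apply, LinearEquiv.mul_apply, H'.act, H.act, mulVec_mulVec],
   fun s => by rw [LinearEquiv.mul_apply, H.norm, H'.norm]⟩

/-- Conjugating `v` by `1 + u w` in the Clifford algebra is the Eichler transformation; this is seen
by moving `v` past `w` and `u`. -/
theorem spinTransvection {u w : Fin 7 → R} (hu : splitForm7 u = 0) (huw : splitPolar7 u w = 0)
    (hg : ∀ v, g *ᵥ v = v + (splitPolar7 w v - splitForm7 w * splitPolar7 u v) • u -
      splitPolar7 u v • w) : IsSpinLift g (spinTransvection u w hu huw) where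
  act v s := by
    have h1 : clifford w (clifford u (clifford w s)) = -(splitForm7 w • clifford u s) := by
      rw [clifford_swap u w, huw, zero_smul, zero_sub, map_neg, clifford_clifford_self]
    have h2 : clifford v (clifford u (clifford w s)) = splitPolar7 u v • clifford w s -
        splitPolar7 w v • clifford u s + clifford u (clifford w (clifford v s)) := by
      rw [clifford_swap w v, map_sub, clifford_swap u v]
      simp
    rw [spinTransvection_apply, spinTransvection_apply, hg]
    simp only [map_add, map_sub, map_smul, LinearMap.add_apply, LinearMap.sub_apply,
      LinearMap.smul_apply, clifford_clifford_self u, hu, h1, h2]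
    module
  norm s := by
    rw [spinTransvection_apply, spinNorm_add, spinNorm_clifford, hu, spinPolar_clifford,
      spinPolar_clifford_clifford, huw]
    ring

end IsSpinLift

end Spinors

/-! ### Root unipotents acting on spinors -/

section RootLifts

open Matrix

variable {R : Type*} [CommRing R]

theorem splitPolar7_single {i : Fin 7} (hi : i ≠ 3) (c : R) (v : Fin 7 → R) :
    splitPolar7 (Pi.single i c) v = c * v i.rev := by
  fin_cases i <;> first | exact absurd rfl hi | simp [splitPolar7, Fin.rev]

theorem splitPolar7_single_three (c : R) (v : Fin 7 → R) :
    splitPolar7 (Pi.single 3 c) v = 2 * (c * v 3) := by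
  simp [splitPolar7]

theorem splitForm7_single {i : Fin 7} (hi : i ≠ 3) (c : R) :
    splitForm7 (Pi.single i c : Fin 7 → R) = 0 := by
  fin_cases i <;> first | exact absurd rfl hi | simp [splitForm7]

theorem splitForm7_single_three (c : R) : splitForm7 (Pi.single 3 c : Fin 7 → R) = c ^ 2 := by
  simp [splitForm7]

theorem rev_ne_three {i : Fin 7} (hi : i ≠ 3) : i.rev ≠ 3 := by
  revert hi; revert i; decide

theorem splitPolar7_single_single {i j : Fin 7} (hi : i ≠ 3) (hij : i ≠ j) (c d : R) :
    splitPolar7 (Pi.single i c) (Pi.single j.rev d) = 0 := by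
  rw [splitPolar7_single hi, Pi.single_eq_of_ne (by simpa using hij), mul_zero]

theorem splitPolar7_single_single_three {i : Fin 7} (hi : i ≠ 3) (c d : R) :
    splitPolar7 (Pi.single i c) (Pi.single 3 d) = 0 := by
  rw [splitPolar7_single hi, Pi.single_eq_of_ne (rev_ne_three hi), mul_zero]

/-- Root unipotents are Eichler transformations of a weight vector `u`. The second vector has
nonzero weight for a long root and weight zero for a short one. -/
theorem isSpinLift_longRootMatrix {i j : Fin 7} (hi : i ≠ 3) (hj : j ≠ 3) (hij : i ≠ j) (ξ : R) :
    IsSpinLift (longRootMatrix i j ξ) (spinTransvection (Pi.single i 1) (Pi.single j.rev ξ)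
      (splitForm7_single hi 1) (splitPolar7_single_single hi hij 1 ξ)) := by
  refine IsSpinLift.spinTransvection _ _ fun v => ?_
  rw [splitPolar7_single hi, splitPolar7_single (rev_ne_three hj), splitForm7_single (rev_ne_three hj),
    Fin.rev_rev]
  simp only [longRootMatrix, add_mulVec, sub_mulVec, one_mulVec, single_mulVec]
  ext k
  simp [Pi.single_apply, Function.update_apply, mul_comm]

theorem isSpinLift_shortRootMatrix {i : Fin 7} (hi : i ≠ 3) (ξ : R) :
    IsSpinLift (shortRootMatrix i ξ) (spinTransvection (Pi.single i 1) (Pi.single 3 ξ)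
      (splitForm7_single hi 1) (splitPolar7_single_single_three hi 1 ξ)) := by
  refine IsSpinLift.spinTransvection _ _ fun v => ?_
  rw [splitPolar7_single hi, splitPolar7_single_three, splitForm7_single_three]
  simp only [shortRootMatrix, add_mulVec, sub_mulVec, one_mulVec, single_mulVec]
  ext k
  simp only [Pi.add_apply, Pi.sub_apply, Pi.smul_apply, Function.update_apply, Pi.zero_apply,
    Pi.single_apply, smul_eq_mul]
  split_ifs <;> ring

/-- Every root unipotent lifts to the spinors. -/
theorem exists_isSpinLift_of_mem {x : SO7 R} (hx : x ∈ elementaryRootUnipotents R) :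
    ∃ h, IsSpinLift x.1.1 h := by
  rcases hx with ⟨i, j, hi, hj, hij, hr, ξ, rfl⟩ | ⟨i, hi, ξ, rfl⟩
  · exact ⟨_, isSpinLift_longRootMatrix hi hj hij ξ⟩
  · exact ⟨_, isSpinLift_shortRootMatrix hi ξ⟩

theorem longRootUnipotent_mul (i j : Fin 7) (hi : i ≠ 3) (hj : j ≠ 3) (hij : i ≠ j)
    (hr : j ≠ i.rev) (ξ η : R) : longRootUnipotent i j hi hj hij hr ξ *
      longRootUnipotent i j hi hj hij hr η = longRootUnipotent i j hi hj hij hr (ξ + η) := by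
  have h1 : j ≠ j.rev := by clear hij hr; revert j; decide
  have h2 : i.rev ≠ i := by clear hij hr; revert i; decide
  refine Subtype.ext (Subtype.ext ?_)
  change longRootMatrix i j ξ * longRootMatrix i j η = longRootMatrix i j (ξ + η)
  have h3 : i.rev ≠ j.rev := fun h => hij (Fin.rev_injective h)
  simp only [longRootMatrix, Matrix.add_mul, Matrix.sub_mul, Matrix.mul_add, Matrix.mul_sub,
    Matrix.one_mul, Matrix.mul_one, single_add, single_mul_single_of_ne _ _ _ _ hij.symm,
    single_mul_single_of_ne _ _ _ _ h1, single_mul_single_of_ne _ _ _ _ h2,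
    single_mul_single_of_ne _ _ _ _ h3]
  abel

theorem shortRootUnipotent_mul (i : Fin 7) (hi : i ≠ 3) (ξ η : R) :
    shortRootUnipotent i hi ξ * shortRootUnipotent i hi η = shortRootUnipotent i hi (ξ + η) := by
  refine Subtype.ext (Subtype.ext ?_)
  change shortRootMatrix i ξ * shortRootMatrix i η = shortRootMatrix i (ξ + η)
  have h1 : i.rev ≠ i := by revert hi; revert i; decide
  have h2 : i.rev ≠ 3 := rev_ne_three hi
  have e : single i i.rev ((ξ + η) ^ 2) = single i i.rev (ξ ^ 2) + single i i.rev (η ^ 2) +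
      single i i.rev (2 * ξ * η) := by
    rw [← single_add, ← single_add]; congr 1; ring
  simp only [shortRootMatrix, Matrix.add_mul, Matrix.sub_mul, Matrix.mul_sub,
    Matrix.one_mul, Matrix.mul_one, single_add, mul_add, e, single_mul_single_same,
    single_mul_single_of_ne _ _ _ _ hi.symm, single_mul_single_of_ne _ _ _ _ h1,
    single_mul_single_of_ne _ _ _ _ h2]
  abel

theorem longRootUnipotent_zero (i j : Fin 7) (hi : i ≠ 3) (hj : j ≠ 3) (hij : i ≠ j)
    (hr : j ≠ i.rev) : longRootUnipotent i j hi hj hij hr (0 : R) = 1 := by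
  refine Subtype.ext (Subtype.ext ?_)
  change longRootMatrix i j (0 : R) = 1
  simp [longRootMatrix]

theorem shortRootUnipotent_zero (i : Fin 7) (hi : i ≠ 3) :
    shortRootUnipotent i hi (0 : R) = 1 := by
  refine Subtype.ext (Subtype.ext ?_)
  change shortRootMatrix i (0 : R) = 1
  simp [shortRootMatrix]

theorem inv_mem_elementaryRootUnipotents {x : SO7 R} (hx : x ∈ elementaryRootUnipotents R) :
    x⁻¹ ∈ elementaryRootUnipotents R := by
  rcases hx with ⟨i, j, hi, hj, hij, hr, ξ, rfl⟩ | ⟨i, hi, ξ, rfl⟩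
  · refine Or.inl ⟨i, j, hi, hj, hij, hr, -ξ, inv_eq_of_mul_eq_one_right ?_⟩
    rw [longRootUnipotent_mul, add_neg_cancel, longRootUnipotent_zero]
  · refine Or.inr ⟨i, hi, -ξ, inv_eq_of_mul_eq_one_right ?_⟩
    rw [shortRootUnipotent_mul, add_neg_cancel, shortRootUnipotent_zero]

theorem exists_isSpinLift {g : SO7 R} (hg : g ∈ Subgroup.closure (elementaryRootUnipotents R)) :
    ∃ h, IsSpinLift g.1.1 h := by
  induction hg using Subgroup.closure_induction_left with
  | one => exact ⟨1, IsSpinLift.one⟩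
  | mul_left x hx y _ ih =>
    obtain ⟨h, hh⟩ := ih
    obtain ⟨h', hh'⟩ := exists_isSpinLift_of_mem hx
    exact ⟨h' * h, hh'.mul hh⟩
  | inv_mul_cancel x hx y _ ih =>
    obtain ⟨h, hh⟩ := ih
    obtain ⟨h', hh'⟩ := exists_isSpinLift_of_mem (inv_mem_elementaryRootUnipotents hx)
    exact ⟨h' * h, hh'.mul hh⟩

/-- `g` is a product of at most `n` elementary root unipotents. -/
def IsRootWord (n : ℕ) (g : SO7 R) : Prop :=
  ∃ l : List (SO7 R), (∀ x ∈ l, x ∈ elementaryRootUnipotents R) ∧ l.prod = g ∧ l.length ≤ n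

namespace IsRootWord

variable {n m : ℕ} {g x : SO7 R}

theorem one : IsRootWord 0 (1 : SO7 R) := ⟨[], by simp, rfl, le_rfl⟩

theorem mul {y : SO7 R} (hx : IsRootWord n x) (hy : IsRootWord m y) :
    IsRootWord (n + m) (x * y) := by
  obtain ⟨l, hl, rfl, hn⟩ := hx
  obtain ⟨l', hl', rfl, hm⟩ := hy
  exact ⟨l ++ l', fun x hx => (List.mem_append.mp hx).elim (hl x) (hl' x), by simp,
    by simp; omega⟩

theorem of_mem (hx : x ∈ elementaryRootUnipotents R) : IsRootWord 1 x :=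
  ⟨[x], by simpa using hx, by simp, by simp⟩

theorem of_mul (hx : x ∈ elementaryRootUnipotents R) (h : IsRootWord n (x * g)) :
    IsRootWord (n + 1) g := by
  have := (of_mem (inv_mem_elementaryRootUnipotents hx)).mul h
  rwa [inv_mul_cancel_left, add_comm] at this

theorem mono (h : IsRootWord n g) (hnm : n ≤ m) : IsRootWord m g := by
  obtain ⟨l, hl, hg, hn⟩ := h
  exact ⟨l, hl, hg, hn.trans hnm⟩

end IsRootWord

/-- The highest weight spinor. -/
def highestSpinor : Fin 8 → R := ![1, 0, 0, 0, 0, 0, 0, 0]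

/-- Every element with a lift moving the highest weight spinor to `s` is a product of at most `n`
elementary root unipotents. -/
def SpinBound (n : ℕ) (s : Fin 8 → R) : Prop :=
  ∀ (g : SO7 R) (h : (Fin 8 → R) ≃ₗ[R] (Fin 8 → R)), IsSpinLift g.1.1 h →
    h highestSpinor = s → IsRootWord n g

namespace SpinBound

variable {n : ℕ}

theorem mono {m : ℕ} {s : Fin 8 → R} (h : SpinBound n s) (hnm : n ≤ m) : SpinBound m s :=
  fun g k hk hs => (h g k hk hs).mono hnm

/-- This turns the shortening of group elements into the reduction of a spinor, one root unipotent
per step. -/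
theorem of_lift {s t : Fin 8 → R} {x : SO7 R} (hx : x ∈ elementaryRootUnipotents R)
    {k : (Fin 8 → R) ≃ₗ[R] (Fin 8 → R)} (hk : IsSpinLift x.1.1 k) (hs : k s = t)
    (H : SpinBound n t) : SpinBound (n + 1) s := by
  intro g h hh hgs
  refine IsRootWord.of_mul hx (H (x * g) (k * h) (hk.mul hh) ?_)
  rw [LinearEquiv.mul_apply, hgs, hs]

theorem of_long {s t : Fin 8 → R} (i j : Fin 7) (hi : i ≠ 3) (hj : j ≠ 3) (hij : i ≠ j)
    (hr : j ≠ i.rev) (ξ : R)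
    (hs : s + clifford (Pi.single i 1) (clifford (Pi.single j.rev ξ) s) = t)
    (H : SpinBound n t) : SpinBound (n + 1) s :=
  of_lift (x := longRootUnipotent i j hi hj hij hr ξ)
    (Or.inl ⟨i, j, hi, hj, hij, hr, ξ, rfl⟩) (isSpinLift_longRootMatrix hi hj hij ξ) hs H

theorem of_short {s t : Fin 8 → R} (i : Fin 7) (hi : i ≠ 3) (ξ : R)
    (hs : s + clifford (Pi.single i 1) (clifford (Pi.single 3 ξ) s) = t)
    (H : SpinBound n t) : SpinBound (n + 1) s :=
  of_lift (x := shortRootUnipotent i hi ξ) (Or.inr ⟨i, hi, ξ, rfl⟩)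
    (isSpinLift_shortRootMatrix hi ξ) hs H

variable {a p₁ p₂ p₃ r₁ r₂ r₃ d : R}

/-- Weights of spinors are `(±ε₁ ± ε₂ ± ε₃) / 2`. The coordinates `a` and `d` belong to the highest
and lowest weight; `p` with index `i` has its only plus sign at `εᵢ`, and `r` its only minus sign. A
root moves each coordinate to the one whose weight differs by that root. -/
theorem longPos₁ (ξ : R) (H : SpinBound n ![a + ξ * p₁, p₁, p₂, p₃, r₁ + ξ * d, r₂, r₃, d]) :
    SpinBound (n + 1) ![a, p₁, p₂, p₃, r₁, r₂, r₃, d] :=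
  of_long 1 4 (by decide) (by decide) (by decide) (by decide) ξ
    (by ext i; fin_cases i <;> simp [clifford_apply, Fin.rev]) H

theorem longPos₂ (ξ : R) (H : SpinBound n ![a + ξ * p₂, p₁, p₂, p₃, r₁, r₂ + ξ * d, r₃, d]) :
    SpinBound (n + 1) ![a, p₁, p₂, p₃, r₁, r₂, r₃, d] :=
  of_long 2 6 (by decide) (by decide) (by decide) (by decide) ξ
    (by ext i; fin_cases i <;> simp [clifford_apply, Fin.rev]) H

theorem longNeg₁ (ξ : R) (H : SpinBound n ![a, p₁ - ξ * a, p₂, p₃, r₁, r₂, r₃, d - ξ * r₁]) :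
    SpinBound (n + 1) ![a, p₁, p₂, p₃, r₁, r₂, r₃, d] :=
  of_long 5 2 (by decide) (by decide) (by decide) (by decide) ξ
    (by ext i; fin_cases i <;> simp [clifford_apply, Fin.rev, sub_eq_add_neg]) H

theorem longNeg₂ (ξ : R) (H : SpinBound n ![a, p₁, p₂ - ξ * a, p₃, r₁, r₂, r₃, d - ξ * r₂]) :
    SpinBound (n + 1) ![a, p₁, p₂, p₃, r₁, r₂, r₃, d] :=
  of_long 4 0 (by decide) (by decide) (by decide) (by decide) ξ
    (by ext i; fin_cases i <;> simp [clifford_apply, Fin.rev, sub_eq_add_neg]) H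

theorem longNeg₃ (ξ : R) (H : SpinBound n ![a, p₁, p₂, p₃ - ξ * a, r₁, r₂, r₃, d - ξ * r₃]) :
    SpinBound (n + 1) ![a, p₁, p₂, p₃, r₁, r₂, r₃, d] :=
  of_long 6 1 (by decide) (by decide) (by decide) (by decide) ξ
    (by ext i; fin_cases i <;> simp [clifford_apply, Fin.rev, sub_eq_add_neg]) H

theorem shortPos₁ (ξ : R) (H : SpinBound n
    ![a - ξ * r₁, p₁ - ξ * d, p₂, p₃, r₁, r₂ - ξ * p₃, r₃ + ξ * p₂, d]) :
    SpinBound (n + 1) ![a, p₁, p₂, p₃, r₁, r₂, r₃, d] :=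
  of_short 0 (by decide) ξ
    (by ext i; fin_cases i <;> simp [clifford_apply, sub_eq_add_neg]) H

theorem shortPos₂ (ξ : R) (H : SpinBound n
    ![a - ξ * r₂, p₁, p₂ - ξ * d, p₃, r₁ + ξ * p₃, r₂, r₃ - ξ * p₁, d]) :
    SpinBound (n + 1) ![a, p₁, p₂, p₃, r₁, r₂, r₃, d] :=
  of_short 1 (by decide) ξ
    (by ext i; fin_cases i <;> simp [clifford_apply, sub_eq_add_neg]) H

theorem shortPos₃ (ξ : R) (H : SpinBound n
    ![a - ξ * r₃, p₁, p₂, p₃ - ξ * d, r₁ - ξ * p₂, r₂ + ξ * p₁, r₃, d]) :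
    SpinBound (n + 1) ![a, p₁, p₂, p₃, r₁, r₂, r₃, d] :=
  of_short 2 (by decide) ξ
    (by ext i; fin_cases i <;> simp [clifford_apply, sub_eq_add_neg]) H

theorem shortNeg₁ (ξ : R) (H : SpinBound n
    ![a, p₁, p₂ - ξ * r₃, p₃ + ξ * r₂, r₁ + ξ * a, r₂, r₃, d + ξ * p₁]) :
    SpinBound (n + 1) ![a, p₁, p₂, p₃, r₁, r₂, r₃, d] :=
  of_short 6 (by decide) ξ
    (by ext i; fin_cases i <;> simp [clifford_apply, sub_eq_add_neg]) H

theorem shortNeg₂ (ξ : R) (H : SpinBound n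
    ![a, p₁ + ξ * r₃, p₂, p₃ - ξ * r₁, r₁, r₂ + ξ * a, r₃, d + ξ * p₂]) :
    SpinBound (n + 1) ![a, p₁, p₂, p₃, r₁, r₂, r₃, d] :=
  of_short 5 (by decide) ξ
    (by ext i; fin_cases i <;> simp [clifford_apply, sub_eq_add_neg]) H

theorem shortNeg₃ (ξ : R) (H : SpinBound n
    ![a, p₁ - ξ * r₂, p₂ + ξ * r₁, p₃, r₁, r₂, r₃ + ξ * a, d + ξ * p₃]) :
    SpinBound (n + 1) ![a, p₁, p₂, p₃, r₁, r₂, r₃, d] :=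
  of_short 4 (by decide) ξ
    (by ext i; fin_cases i <;> simp [clifford_apply, sub_eq_add_neg]) H

end SpinBound

end RootLifts

/-! ### Reduction of a unimodular isotropic spinor -/

namespace SpinBound

section CommRing

variable {R : Type*} [CommRing R] {n : ℕ} {a p₁ p₂ p₃ r₁ r₂ r₃ d : R}

/-- In bounding the length one may assume that the spinor is isotropic and unimodular. -/
theorem of_forall {s : Fin 8 → R} (H : spinNorm s = 0 →
    (∀ p, (∀ i, p ∣ s i) → IsUnit p) → SpinBound n s) : SpinBound n s := by
  intro g h hh hs
  refine H ?_ ?_ g h hh hs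
  · rw [← hs, hh.norm]; simp [spinNorm, highestSpinor]
  · intro p hd
    choose t ht using hd
    have hst : s = p • t := funext fun i => by simp [ht i]
    have h1 : highestSpinor = p • h.symm t := by
      rw [← map_smul, ← hst, ← hs, LinearEquiv.symm_apply_apply]
    exact isUnit_of_dvd_one ⟨h.symm t 0, by simpa [highestSpinor] using congrFun h1 0⟩

theorem of_isotropic (H : SpinBound n (highestSpinor : Fin 8 → R)) :
    SpinBound n ![1, 0, 0, 0, 0, 0, 0, d] := by
  refine of_forall fun hN _ => ?_
  obtain rfl : d = 0 := by simpa [spinNorm] using hN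
  exact H

/-- The entry `1` clears the three `r` by negative short roots and the three `p` by negative long
ones; isotropy then forces `d = 0`. -/
theorem of_one (H : SpinBound n (highestSpinor : Fin 8 → R)) :
    SpinBound (n + 6) ![1, p₁, p₂, p₃, r₁, r₂, r₃, d] := by
  have hp : ∀ p₁ p₂ p₃ d : R, SpinBound (n + 3) ![1, p₁, p₂, p₃, 0, 0, 0, d] := by
    intro p₁ p₂ p₃ d
    refine longNeg₁ p₁ ?_
    rw [mul_one, sub_self]
    refine longNeg₂ p₂ ?_
    rw [mul_one, sub_self]
    refine longNeg₃ p₃ ?_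
    rw [mul_one, sub_self]
    exact of_isotropic H
  refine shortNeg₁ (-r₁) ?_
  rw [mul_one, add_neg_cancel]
  refine shortNeg₂ (-r₂) ?_
  rw [mul_one, add_neg_cancel]
  refine shortNeg₃ (-r₃) ?_
  rw [mul_one, add_neg_cancel]
  exact hp _ _ _ _

theorem of_isCoprime_p (H : SpinBound n (highestSpinor : Fin 8 → R)) (h : IsCoprime p₁ p₂) :
    SpinBound (n + 8) ![a, p₁, p₂, p₃, r₁, r₂, r₃, d] := by
  obtain ⟨u, v, huv⟩ := h
  refine longPos₁ (u * (1 - a)) (longPos₂ (v * (1 - a)) ?_)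
  have e : a + u * (1 - a) * p₁ + v * (1 - a) * p₂ = 1 := by linear_combination (1 - a) * huv
  rw [e]
  exact of_one H

end CommRing

variable {R : Type*} [CommRing R] [IsDomain R] [IsPrincipalIdealRing R] {n : ℕ}
  {a p₁ p₂ p₃ r₁ r₂ r₃ d : R}

/-- Two operations that fix `p₂` make `p₁` prime to it. The first ensures that no prime divisor of
`p₂` divides both `p₁` and `d`, which is possible as `a` and `d` are coprime; the second then adds a
multiple of `d` to `p₁`. -/
theorem of_isCoprime_of_ne_zero (H : SpinBound n (highestSpinor : Fin 8 → R))
    (h : IsCoprime a d) (h₂ : p₂ ≠ 0) :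
    SpinBound (n + 10) ![a, p₁, p₂, p₃, r₁, r₂, r₃, d] := by
  obtain ⟨η, hη⟩ := exists_add_mul_not_dvd h₂ ![p₁, d] ![-a, -r₁] fun p hp _ hv hw => by
    have h1 : p ∣ a := by simpa using hw 0
    exact hp.not_isUnit (h.isUnit_of_dvd' h1 (hv 1))
  obtain ⟨ξ, hξ⟩ := exists_isCoprime_add_mul (y := p₁ - η * a) (z := -(d - η * r₁)) h₂
    fun p hp hpd h1 h2 => by
      obtain ⟨i, hi⟩ := hη p hp hpd
      rw [dvd_neg] at h2
      fin_cases i <;> simp [← sub_eq_add_neg] at hi <;> contradiction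
  refine longNeg₁ η (shortPos₁ ξ (of_isCoprime_p H ?_))
  rw [mul_neg, ← sub_eq_add_neg] at hξ
  exact hξ.symm

theorem of_isCoprime (H : SpinBound n (highestSpinor : Fin 8 → R)) (h : IsCoprime a d) :
    SpinBound (n + 11) ![a, p₁, p₂, p₃, r₁, r₂, r₃, d] := by
  by_cases h₂ : p₂ = 0
  -- One operation makes `p₂` nonzero, using `d` if `a = 0`. Otherwise `-a ^ 2` is put there, which
  -- changes `d` by a multiple of `a` and so preserves coprimality.
  · by_cases ha : a = 0
    · have hd : IsUnit d := by rwa [ha, isCoprime_zero_left] at h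
      refine shortPos₂ 1 (of_isCoprime_of_ne_zero H ?_ ?_)
      · obtain ⟨e, he⟩ := hd.exists_left_inv
        exact ⟨0, e, by rw [zero_mul, zero_add, he]⟩
      · rw [h₂, zero_sub, one_mul]; exact neg_ne_zero.mpr hd.ne_zero
    · refine longNeg₂ a (of_isCoprime_of_ne_zero H ?_ ?_)
      · rw [sub_eq_add_neg, ← mul_neg]
        exact h.add_mul_left_right _
      · rw [h₂, zero_sub]; exact neg_ne_zero.mpr (mul_ne_zero ha ha)
  · exact (of_isCoprime_of_ne_zero H h h₂).mono (by omega)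

/-- The three positive short roots leave `d` alone. Modulo each prime divisor of `d` the spinor is
nonzero; the parameters successively make nonzero the vectors `(a, r₂, r₃, p₁)`, then `(a, r₃)`,
then `a`, so that `a` becomes prime to `d`. -/
theorem of_ne_zero (H : SpinBound n (highestSpinor : Fin 8 → R)) (hd : d ≠ 0) :
    SpinBound (n + 14) ![a, p₁, p₂, p₃, r₁, r₂, r₃, d] := by
  refine of_forall fun _ huni => ?_
  obtain ⟨ξ₁, h₁⟩ := exists_add_mul_not_dvd hd ![a, r₂, r₃, p₁] ![-r₁, -p₃, p₂, 0]
    fun p hp hpd hv hw => hp.not_isUnit <| huni p fun i => by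
      have e0 := hv 0
      have e1 := hv 1
      have e2 := hv 2
      have e3 := hv 3
      have f0 := hw 0
      have f1 := hw 1
      have f2 := hw 2
      simp at e0 e1 e2 e3 f0 f1 f2
      fin_cases i <;> simpa
  obtain ⟨ξ₂, h₂⟩ := exists_add_mul_not_dvd hd ![a - ξ₁ * r₁, r₃ + ξ₁ * p₂]
    ![-(r₂ - ξ₁ * p₃), -(p₁ - ξ₁ * d)] fun p hp hpd hv hw => by
      have e0 := hv 0
      have e1 := hv 1
      have f0 := hw 0
      have f1 := hw 1
      simp only [Matrix.cons_val_zero, Matrix.cons_val_one, dvd_neg] at e0 e1 f0 f1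
      have f2 : p ∣ p₁ := (dvd_sub_left (hpd.mul_left ξ₁)).mp f1
      obtain ⟨i, hi⟩ := h₁ p hp hpd
      fin_cases i <;> simp [← sub_eq_add_neg] at hi <;> contradiction
  obtain ⟨ξ₃, h₃⟩ := exists_isCoprime_add_mul (y := a - ξ₁ * r₁ - ξ₂ * (r₂ - ξ₁ * p₃))
    (z := -(r₃ + ξ₁ * p₂ - ξ₂ * (p₁ - ξ₁ * d))) hd fun p hp hpd h1 h2 => by
      obtain ⟨i, hi⟩ := h₂ p hp hpd
      rw [dvd_neg] at h2
      fin_cases i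
      · simp only [Fin.zero_eta, Matrix.cons_val_zero, mul_neg, ← sub_eq_add_neg] at hi
        contradiction
      · simp only [Fin.mk_one, Matrix.cons_val_one, Matrix.cons_val_zero, mul_neg,
          ← sub_eq_add_neg] at hi
        contradiction
  refine shortPos₁ ξ₁ (shortPos₂ ξ₂ (shortPos₃ ξ₃ (of_isCoprime H ?_)))
  rw [mul_neg, ← sub_eq_add_neg] at h₃
  exact h₃.symm

/-- Fifteen elementary root unipotents suffice to move an isotropic unimodular spinor to the highest
weight spinor. -/
theorem add_fifteen (H : SpinBound n (highestSpinor : Fin 8 → R)) (s : Fin 8 → R) :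
    SpinBound (n + 15) s := by
  obtain ⟨a, p₁, p₂, p₃, r₁, r₂, r₃, d, rfl⟩ : ∃ a p₁ p₂ p₃ r₁ r₂ r₃ d,
      s = ![a, p₁, p₂, p₃, r₁, r₂, r₃, d] :=
    ⟨s 0, s 1, s 2, s 3, s 4, s 5, s 6, s 7, by ext i; fin_cases i <;> rfl⟩
  by_cases hd : d = 0
  swap
  · exact (of_ne_zero H hd).mono (by omega)
  subst hd
  by_cases h₁ : p₁ = 0
  swap
  · exact shortNeg₁ 1 (of_ne_zero H (by simpa using h₁))
  by_cases h₂ : p₂ = 0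
  swap
  · exact shortNeg₂ 1 (of_ne_zero H (by simpa using h₂))
  by_cases h₃ : p₃ = 0
  swap
  · exact shortNeg₃ 1 (of_ne_zero H (by simpa using h₃))
  by_cases h₄ : r₁ = 0
  swap
  · exact longNeg₁ 1 (of_ne_zero H (by simpa using h₄))
  by_cases h₅ : r₂ = 0
  swap
  · exact longNeg₂ 1 (of_ne_zero H (by simpa using h₅))
  by_cases h₆ : r₃ = 0
  swap
  · exact longNeg₃ 1 (of_ne_zero H (by simpa using h₆))
  subst h₁ h₂ h₃ h₄ h₅ h₆
  refine of_forall fun _ huni => ?_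
  have ha : IsUnit a := huni a fun i => by fin_cases i <;> simp
  obtain ⟨a', ha'⟩ := ha.exists_right_inv
  refine SpinBound.mono (n := n + 8) ?_ (by omega)
  -- Only the unit `a` is left. It is copied to `r₁`, and subtracting `(1 - a') a` from it gives `a'
  -- a = 1`.
  refine shortNeg₁ 1 (shortPos₁ (1 - a') ?_)
  have e : a - (1 - a') * (0 + 1 * a) = 1 := by linear_combination ha'
  rw [e]
  exact of_one H

end SpinBound

/-! ### The stabilizer of the highest weight spinor -/

section Stabilizer

open Matrix

variable {R : Type*} [CommRing R]

theorem spinPolar_map {g : Matrix (Fin 7) (Fin 7) R} {h : (Fin 8 → R) ≃ₗ[R] (Fin 8 → R)}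
    (hh : IsSpinLift g h) (s t : Fin 8 → R) : spinPolar (h s) (h t) = spinPolar s t := by
  have h1 := spinNorm_add (h s) (h t)
  rw [← map_add, hh.norm, hh.norm, hh.norm, spinNorm_add] at h1
  exact (add_left_cancel h1).symm

theorem splitPolar7_mulVec (g : SO7 R) (v w : Fin 7 → R) :
    splitPolar7 (g.1.1 *ᵥ v) (g.1.1 *ᵥ w) = splitPolar7 v w := by
  have h1 := splitForm7_add (g.1.1 *ᵥ v) (g.1.1 *ᵥ w)
  have hg := g.2
  rw [← mulVec_add, hg, hg, hg, splitForm7_add] at h1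
  exact (add_left_cancel h1).symm

/-- The span of the weight vectors of weights `ε₁, ε₂, ε₃`. -/
def positiveVector (w : Fin 3 → R) : Fin 7 → R := ![w 0, w 1, w 2, 0, 0, 0, 0]

/-- The long root unipotent corresponding to a transvection of `GL 3`. -/
def leviUnipotent (t : TransvectionStruct (Fin 3) R) : SO7 R :=
  longRootUnipotent (t.i.castLE (by decide)) (t.j.castLE (by decide))
    (by have := t.i.isLt; simp [Fin.ext_iff]; omega)
    (by have := t.j.isLt; simp [Fin.ext_iff]; omega)
    (fun h => t.hij (Fin.castLE_injective _ h))
    (by have := t.i.isLt; have := t.j.isLt; simp [Fin.ext_iff]; omega) t.c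

theorem leviUnipotent_mem (t : TransvectionStruct (Fin 3) R) :
    leviUnipotent t ∈ elementaryRootUnipotents R :=
  Or.inl ⟨_, _, _, _, _, _, _, rfl⟩

theorem leviUnipotent_mulVec_positiveVector (t : TransvectionStruct (Fin 3) R) (w : Fin 3 → R) :
    (leviUnipotent t).1.1 *ᵥ positiveVector w = positiveVector (t.toMatrix *ᵥ w) := by
  obtain ⟨i, j, hij, c⟩ := t
  change longRootMatrix _ _ c *ᵥ _ = _
  simp only [longRootMatrix, add_mulVec, sub_mulVec, one_mulVec, single_mulVec,
    TransvectionStruct.toMatrix_mk, transvection]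
  ext k
  fin_cases i <;> fin_cases j <;> first | exact absurd rfl hij | skip
  all_goals
    simp only [Pi.add_apply, Pi.sub_apply, Function.update_apply]
    fin_cases k <;> simp [positiveVector, Fin.rev, Fin.ext_iff]

theorem leviUnipotent_mulVec_three (t : TransvectionStruct (Fin 3) R) (v : Fin 7 → R) :
    ((leviUnipotent t).1.1 *ᵥ v) 3 = v 3 := by
  obtain ⟨i, j, hij, c⟩ := t
  change (longRootMatrix _ _ c *ᵥ _) 3 = _
  simp only [longRootMatrix, add_mulVec, sub_mulVec, one_mulVec, single_mulVec]
  fin_cases i <;> fin_cases j <;> simp [Fin.rev, Fin.ext_iff]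

theorem coe_mul_mulVec (g g' : SO7 R) (v : Fin 7 → R) :
    (g * g').1.1 *ᵥ v = g.1.1 *ᵥ (g'.1.1 *ᵥ v) :=
  (mulVec_mulVec v g.1.1 g'.1.1).symm

theorem prod_leviUnipotent_mulVec (l : List (TransvectionStruct (Fin 3) R)) :
    (∀ w, (l.map leviUnipotent).prod.1.1 *ᵥ positiveVector w =
      positiveVector ((l.map TransvectionStruct.toMatrix).prod *ᵥ w)) ∧
    ∀ v, ((l.map leviUnipotent).prod.1.1 *ᵥ v) 3 = v 3 := by
  induction l with
  | nil =>
    refine ⟨fun w => ?_, fun v => ?_⟩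
    · change (1 : Matrix (Fin 7) (Fin 7) R) *ᵥ _ = _
      simp
    · change ((1 : Matrix (Fin 7) (Fin 7) R) *ᵥ _) 3 = _
      simp
  | cons t l ih =>
    refine ⟨fun w => ?_, fun v => ?_⟩
    · rw [List.map_cons, List.prod_cons, coe_mul_mulVec, ih.1,
        leviUnipotent_mulVec_positiveVector, List.map_cons, List.prod_cons, mulVec_mulVec]
    · rw [List.map_cons, List.prod_cons, coe_mul_mulVec, leviUnipotent_mulVec_three, ih.2]

theorem IsRootWord.prod_leviUnipotent (l : List (TransvectionStruct (Fin 3) R)) :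
    IsRootWord l.length (l.map leviUnipotent).prod :=
  ⟨l.map leviUnipotent, by simpa using fun t _ => leviUnipotent_mem t, rfl, by simp⟩

theorem IsRootWord.inv {n : ℕ} {g : SO7 R} (h : IsRootWord n g) : IsRootWord n g⁻¹ := by
  obtain ⟨l, hl, rfl, hn⟩ := h
  refine ⟨(l.map (·⁻¹)).reverse, fun x hx => ?_, List.prod_inv_reverse l ▸ rfl, by simpa using hn⟩
  obtain ⟨y, hy, rfl⟩ := List.mem_map.mp (List.mem_reverse.mp hx)
  exact inv_mem_elementaryRootUnipotents (hl y hy)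

section Unipotent

variable (a b c d e f k ξ : R)

theorem shortRootMatrix_zero_mulVec : shortRootMatrix 0 ξ *ᵥ ![a, b, c, d, e, f, k] =
    ![a + 2 * ξ * d - ξ ^ 2 * k, b, c, d - ξ * k, e, f, k] := by
  simp only [shortRootMatrix, add_mulVec, sub_mulVec, one_mulVec, single_mulVec]
  ext i
  simp only [Pi.add_apply, Pi.sub_apply, Function.update_apply]
  fin_cases i <;> simp [Fin.rev]

theorem shortRootMatrix_one_mulVec : shortRootMatrix 1 ξ *ᵥ ![a, b, c, d, e, f, k] =
    ![a, b + 2 * ξ * d - ξ ^ 2 * f, c, d - ξ * f, e, f, k] := by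
  simp only [shortRootMatrix, add_mulVec, sub_mulVec, one_mulVec, single_mulVec]
  ext i
  simp only [Pi.add_apply, Pi.sub_apply, Function.update_apply]
  fin_cases i <;> simp [Fin.rev]

theorem shortRootMatrix_two_mulVec : shortRootMatrix 2 ξ *ᵥ ![a, b, c, d, e, f, k] =
    ![a, b, c + 2 * ξ * d - ξ ^ 2 * e, d - ξ * e, e, f, k] := by
  simp only [shortRootMatrix, add_mulVec, sub_mulVec, one_mulVec, single_mulVec]
  ext i
  simp only [Pi.add_apply, Pi.sub_apply, Function.update_apply]
  fin_cases i <;> simp [Fin.rev]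

theorem longRootMatrix_zero_five_mulVec : longRootMatrix 0 5 ξ *ᵥ ![a, b, c, d, e, f, k] =
    ![a + ξ * f, b - ξ * k, c, d, e, f, k] := by
  simp only [longRootMatrix, add_mulVec, sub_mulVec, one_mulVec, single_mulVec]
  ext i
  simp only [Pi.add_apply, Pi.sub_apply, Function.update_apply]
  fin_cases i <;> simp [Fin.rev]

theorem longRootMatrix_zero_four_mulVec : longRootMatrix 0 4 ξ *ᵥ ![a, b, c, d, e, f, k] =
    ![a + ξ * e, b, c - ξ * k, d, e, f, k] := by
  simp only [longRootMatrix, add_mulVec, sub_mulVec, one_mulVec, single_mulVec]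
  ext i
  simp only [Pi.add_apply, Pi.sub_apply, Function.update_apply]
  fin_cases i <;> simp [Fin.rev]

theorem longRootMatrix_one_four_mulVec : longRootMatrix 1 4 ξ *ᵥ ![a, b, c, d, e, f, k] =
    ![a, b + ξ * e, c - ξ * f, d, e, f, k] := by
  simp only [longRootMatrix, add_mulVec, sub_mulVec, one_mulVec, single_mulVec]
  ext i
  simp only [Pi.add_apply, Pi.sub_apply, Function.update_apply]
  fin_cases i <;> simp [Fin.rev]

end Unipotent

/-- An element fixing the weight vectors of weights `ε₁, ε₂, ε₃` is a product of six elementary root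
unipotents. -/
theorem IsRootWord.of_fixes_positiveVector {u : SO7 R}
    (hu : ∀ w, u.1.1 *ᵥ positiveVector w = positiveVector w)
    (h33 : (u.1.1 *ᵥ Pi.single 3 1) 3 = 1) : IsRootWord 6 u := by
  -- Pairing with the fixed positive vectors shows that `u` does not change the last three
  -- coordinates.
  have hpos : ∀ w v, splitPolar7 (positiveVector w) (u.1.1 *ᵥ v) =
      splitPolar7 (positiveVector w) v := fun w v => by
    rw [← splitPolar7_mulVec u (positiveVector w) v, hu]
  have hlow : ∀ v, (u.1.1 *ᵥ v) 4 = v 4 ∧ (u.1.1 *ᵥ v) 5 = v 5 ∧ (u.1.1 *ᵥ v) 6 = v 6 := by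
    intro v
    have h0 := hpos ![1, 0, 0] v
    have h1 := hpos ![0, 1, 0] v
    have h2 := hpos ![0, 0, 1] v
    simp [splitPolar7, positiveVector] at h0 h1 h2
    exact ⟨h2, h1, h0⟩
  have hcol : ∀ v : Fin 7 → R, ∃ a b c d, u.1.1 *ᵥ v = ![a, b, c, d, v 4, v 5, v 6] := by
    intro v
    obtain ⟨h4, h5, h6⟩ := hlow v
    refine ⟨(u.1.1 *ᵥ v) 0, (u.1.1 *ᵥ v) 1, (u.1.1 *ᵥ v) 2, (u.1.1 *ᵥ v) 3, ?_⟩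
    ext i
    fin_cases i <;> simp [h4, h5, h6]
  obtain ⟨x₀, x₁, x₂, x₃, e₃⟩ := hcol (Pi.single 3 1)
  obtain ⟨a₄, b₄, c₄, d₄, e₄⟩ := hcol (Pi.single 4 1)
  obtain ⟨a₅, b₅, c₅, d₅, e₅⟩ := hcol (Pi.single 5 1)
  obtain ⟨a₆, b₆, c₆, d₆, e₆⟩ := hcol (Pi.single 6 1)
  obtain rfl : x₃ = 1 := by rw [e₃] at h33; simpa using h33
  have q₄ := u.2 (Pi.single 4 1)
  have q₅ := u.2 (Pi.single 5 1)
  have q₆ := u.2 (Pi.single 6 1)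
  have p₃₄ := splitPolar7_mulVec u (Pi.single 3 1) (Pi.single 4 1)
  have p₃₅ := splitPolar7_mulVec u (Pi.single 3 1) (Pi.single 5 1)
  have p₃₆ := splitPolar7_mulVec u (Pi.single 3 1) (Pi.single 6 1)
  have p₄₅ := splitPolar7_mulVec u (Pi.single 4 1) (Pi.single 5 1)
  have p₄₆ := splitPolar7_mulVec u (Pi.single 4 1) (Pi.single 6 1)
  have p₅₆ := splitPolar7_mulVec u (Pi.single 5 1) (Pi.single 6 1)
  rw [e₄] at q₄
  rw [e₅] at q₅
  rw [e₆] at q₆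
  rw [e₃, e₄] at p₃₄
  rw [e₃, e₅] at p₃₅
  rw [e₃, e₆] at p₃₆
  rw [e₄, e₅] at p₄₅
  rw [e₄, e₆] at p₄₆
  rw [e₅, e₆] at p₅₆
  simp [splitForm7] at q₄ q₅ q₆
  simp [splitPolar7] at p₃₄ p₃₅ p₃₆ p₄₅ p₄₆ p₅₆
  have f₀ : (Pi.single 0 1 : Fin 7 → R) = positiveVector ![1, 0, 0] := by
    ext i; fin_cases i <;> rfl
  have f₁ : (Pi.single 1 1 : Fin 7 → R) = positiveVector ![0, 1, 0] := by
    ext i; fin_cases i <;> rfl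
  have f₂ : (Pi.single 2 1 : Fin 7 → R) = positiveVector ![0, 0, 1] := by
    ext i; fin_cases i <;> rfl
  have e₀ : u.1.1 *ᵥ Pi.single 0 1 = ![1, 0, 0, 0, 0, 0, 0] := by rw [f₀]; exact hu _
  have e₁ : u.1.1 *ᵥ Pi.single 1 1 = ![0, 1, 0, 0, 0, 0, 0] := by rw [f₁]; exact hu _
  have e₂ : u.1.1 *ᵥ Pi.single 2 1 = ![0, 0, 1, 0, 0, 0, 0] := by rw [f₂]; exact hu _
  -- Orthogonality determines all entries from `d₄`, `d₅`, `d₆`, `b₆`, `c₆` and `c₅`, which are the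
  -- parameters of the six root unipotents below.
  obtain rfl := eq_neg_of_add_eq_zero_left q₄
  obtain rfl := eq_neg_of_add_eq_zero_left q₅
  obtain rfl := eq_neg_of_add_eq_zero_left q₆
  obtain rfl := eq_neg_of_add_eq_zero_left p₃₄
  obtain rfl := eq_neg_of_add_eq_zero_left p₃₅
  obtain rfl := eq_neg_of_add_eq_zero_left p₃₆
  rw [add_assoc] at p₄₅ p₄₆ p₅₆
  obtain rfl := eq_neg_of_add_eq_zero_left p₄₅
  obtain rfl := eq_neg_of_add_eq_zero_left p₄₆
  obtain rfl := eq_neg_of_add_eq_zero_left p₅₆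
  refine IsRootWord.of_mul (x := shortRootUnipotent 0 (by decide) d₆) (Or.inr ⟨_, _, _, rfl⟩) ?_
  refine IsRootWord.of_mul (x := shortRootUnipotent 1 (by decide) d₅) (Or.inr ⟨_, _, _, rfl⟩) ?_
  refine IsRootWord.of_mul (x := shortRootUnipotent 2 (by decide) d₄) (Or.inr ⟨_, _, _, rfl⟩) ?_
  refine IsRootWord.of_mul (x := longRootUnipotent 0 5 (by decide) (by decide) (by decide)
    (by decide) b₆) (Or.inl ⟨_, _, _, _, _, _, _, rfl⟩) ?_
  refine IsRootWord.of_mul (x := longRootUnipotent 0 4 (by decide) (by decide) (by decide)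
    (by decide) c₆) (Or.inl ⟨_, _, _, _, _, _, _, rfl⟩) ?_
  refine IsRootWord.of_mul (x := longRootUnipotent 1 4 (by decide) (by decide) (by decide)
    (by decide) c₅) (Or.inl ⟨_, _, _, _, _, _, _, rfl⟩) ?_
  convert IsRootWord.one (R := R)
  refine Subtype.ext (Subtype.ext (ext_of_mulVec_single fun j => ?_))
  simp only [coe_mul_mulVec]
  change longRootMatrix 1 4 c₅ *ᵥ (longRootMatrix 0 4 c₆ *ᵥ (longRootMatrix 0 5 b₆ *ᵥ
    (shortRootMatrix 2 d₄ *ᵥ (shortRootMatrix 1 d₅ *ᵥ (shortRootMatrix 0 d₆ *ᵥ _))))) =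
      (1 : Matrix (Fin 7) (Fin 7) R) *ᵥ _
  rw [one_mulVec]
  fin_cases j <;> simp only [Fin.zero_eta, Fin.mk_one, Fin.reduceFinMk, e₀, e₁, e₂, e₃, e₄, e₅, e₆,
    shortRootMatrix_zero_mulVec, shortRootMatrix_one_mulVec, shortRootMatrix_two_mulVec,
    longRootMatrix_zero_five_mulVec, longRootMatrix_zero_four_mulVec,
    longRootMatrix_one_four_mulVec] <;> ext i <;> fin_cases i <;> simp <;> ring

/-- The vectors annihilating the highest spinor are the positive ones, so an element whose lift
fixes it preserves their span. Its action there has determinant one; undoing this action by Levi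
unipotents leaves the unipotent radical. -/
theorem SpinBound.of_stabilizer {n : ℕ} (H : ∀ A : Matrix (Fin 3) (Fin 3) R, A.det = 1 →
      ∃ l : List (TransvectionStruct (Fin 3) R), l.length ≤ n ∧
        A = (l.map TransvectionStruct.toMatrix).prod) :
    SpinBound (n + 6) (highestSpinor : Fin 8 → R) := by
  intro g h hh he
  have hcl : ∀ v : Fin 7 → R, clifford v highestSpinor = ![v 3, 0, 0, 0, v 6, v 5, v 4, 0] := by
    intro v; ext i; fin_cases i <;> simp [clifford_apply, highestSpinor]
  have hact : ∀ v s, h (clifford v s) = clifford (g.1.1 *ᵥ v) (h s) := hh.act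
  have hpos : ∀ w, ∃ w', g.1.1 *ᵥ positiveVector w = positiveVector w' := by
    intro w
    have h1 := hact (positiveVector w) highestSpinor
    have h2 : clifford (positiveVector w) (highestSpinor : Fin 8 → R) = 0 := by
      rw [hcl]; ext i; fin_cases i <;> rfl
    rw [h2, map_zero, he, hcl] at h1
    have k3 := congrFun h1 0
    have k6 := congrFun h1 4
    have k5 := congrFun h1 5
    have k4 := congrFun h1 6
    simp at k3 k4 k5 k6
    refine ⟨![(g.1.1 *ᵥ positiveVector w) 0, (g.1.1 *ᵥ positiveVector w) 1,
      (g.1.1 *ᵥ positiveVector w) 2], ?_⟩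
    ext i
    fin_cases i
    exacts [rfl, rfl, rfl, k3.symm, k4.symm, k5.symm, k6.symm]
  have h33 : (g.1.1 *ᵥ Pi.single 3 1) 3 = 1 := by
    have h1 := hact (Pi.single 3 1) highestSpinor
    have h2 : clifford (Pi.single 3 1) (highestSpinor : Fin 8 → R) = highestSpinor := by
      rw [hcl]; ext i; fin_cases i <;> simp [highestSpinor]
    rw [h2, he, hcl] at h1
    simpa [highestSpinor] using (congrFun h1 0).symm
  have hseven : ∀ s, h s 7 = s 7 := by
    intro s
    have := spinPolar_map hh highestSpinor s
    rw [he] at this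
    simpa [spinPolar, highestSpinor] using this
  let M : Matrix (Fin 7) (Fin 7) R := g.1.1
  -- The span of the negative weights is dual to the positive one, so this block inverts the action
  -- of `g` on positive vectors.
  let B : Matrix (Fin 3) (Fin 3) R :=
    !![M 6 6, M 5 6, M 4 6; M 6 5, M 5 5, M 4 5; M 6 4, M 5 4, M 4 4]
  have hB : ∀ w w', g.1.1 *ᵥ positiveVector w = positiveVector w' → B *ᵥ w' = w := by
    intro w w' hw
    have k6 := splitPolar7_mulVec g (positiveVector w) (Pi.single 6 1)
    have k5 := splitPolar7_mulVec g (positiveVector w) (Pi.single 5 1)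
    have k4 := splitPolar7_mulVec g (positiveVector w) (Pi.single 4 1)
    rw [hw] at k6 k5 k4
    simp [splitPolar7, positiveVector] at k6 k5 k4
    ext i
    fin_cases i <;> simp [B, M, mulVec, dotProduct, Fin.sum_univ_three]
    · linear_combination k6
    · linear_combination k5
    · linear_combination k4
  have hdet : B.det = 1 := by
    -- The three negative weight vectors carry the highest spinor to minus the lowest one. After
    -- applying `h`, the last coordinate is minus the determinant of the block, and it is preserved
    -- because it is the pairing with the highest spinor.
    have h1 := hseven (clifford (Pi.single 6 1) (clifford (Pi.single 5 1)
      (clifford (Pi.single 4 1) highestSpinor)))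
    rw [hact, hact, hact, he] at h1
    simp [clifford_apply, highestSpinor] at h1
    rw [det_fin_three]
    simp [B, M]
    linear_combination -h1
  obtain ⟨l, hl, hBl⟩ := H B hdet
  have hu : IsRootWord 6 ((l.map leviUnipotent).prod * g) := by
    refine .of_fixes_positiveVector (fun w => ?_) ?_
    · obtain ⟨w', hw'⟩ := hpos w
      rw [coe_mul_mulVec, hw', (prod_leviUnipotent_mulVec l).1, ← hBl, hB w w' hw']
    · rw [coe_mul_mulVec, (prod_leviUnipotent_mulVec l).2, h33]
  have := (IsRootWord.prod_leviUnipotent l).inv.mul hu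
  rw [inv_mul_cancel_left] at this
  exact this.mono (by omega)

theorem IsRootWord.wordLength_le {n : ℕ} {g : SO7 R} (h : IsRootWord n g) :
    wordLength (elementaryRootUnipotents R) g ≤ n := by
  obtain ⟨l, hl, hg, hn⟩ := h
  exact (iInf₂_le l ⟨hl, hg⟩).trans (by exact_mod_cast hn)

end Stabilizer

theorem theorem6p5 (F : Type*) [Field F] [Finite F] :
    elementaryWidthSO7 (Polynomial F) < ⊤ ∧ elementaryWidthSO7 (Polynomial F) ≤ 65 := by
  have key : elementaryWidthSO7 (Polynomial F) ≤ 65 := by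
    refine iSup₂_le fun g hg => ?_
    obtain ⟨h, hh⟩ := exists_isSpinLift hg
    -- The count is 43 for `SL 3`, 6 for the unipotent radical and 15 for the spinor: 64, one less
    -- than required.
    exact (((SpinBound.of_stabilizer exists_list_transvection).add_fifteen _ g h hh rfl).mono
      (by norm_num : 43 + 6 + 15 ≤ 65)).wordLength_le
  exact ⟨key.trans_lt (ENat.natCast_lt_top 65), key⟩
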